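/- **Rules and TBoxes.** A *rule* is a function-free and constant-free sentence $r=\forall \mathbf x\,[\varphi(\mathbf x)\to\exists\mathbf y\,\bigvee_{i=1}^n\psi_i(\mathbf x,\mathbf y)]$ with $n\ge 0$, where $\varphi$ and the $\psi_i$ are conjunctions of distinct atoms, the universally quantified variables of $r$ are exactly the variables of its body $\varphi$, $\top$ does not occur in the head and the nullary falsehood predicate $\bot$ does not occur in the body. A *TBox* $\mathcal T$ is a finite set of rules no two of which share existentially quantified variables; a TBox that mentions equality contains the axioms for equality among its rules. A *signature* $\Sigma$ over $\mathcal T$ is a set of predicates with $\bot\in\Sigma\subseteq\mathrm{sig}(\mathcal T)\cup\{\bot\}$. **Modules.** A *setting* $\chi=\langle\theta,\mathcal A_0,\mathcal A_r\rangle$ for $\mathcal T$ and $\Sigma$ consists of a map $\theta$ from the existentially quantified variables of $\mathcal T$ to fresh constants and two finite sets $\mathcal A_0,\mathcal A_r$ of facts. Its program $\mathcal P^\chi$ contains, for each rule of $\mathcal T$ as above, the *corresponding* datalog rules $\varphi\to\gamma\theta$ for every atom $\gamma$ of every $\psi_i$, or $\varphi\to\bot$ if $n=0$. The module $\mathcal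 M^\chi$ is the set of all $r\in\mathcal T$ such that some corresponding datalog rule occurs in some forward-chaining proof, from $\mathcal P^\chi\cup\mathcal A_0$, of a fact from $\mathcal A_r$ (facts over $\top$ hold trivially). With pairwise distinct fresh constants $*$, $c_y$ (for each existentially quantified variable $y$) and $c_A^1,\dots,c_A^k$ (for each $A\in\Sigma$ of arity $k$), the settings $\chi_z$ are: - $\chi_{\mathsf m}$: $\theta(y)=*$ for all $y$, $\mathcal A_0=\mathcal A_r=\{A(*,\dots,*)\mid A\in\Sigma\}$; - $\chi_{\mathsf f}$: $\theta(y)=c_y$, $\mathcal A_0=\mathcal A_r=\{A(*,\dots,*)\mid A\in\Sigma\}$; - $\chi_{\mathsf q}$: $\theta$ and $\mathcal A_0$ as in $\chi_{\mathsf f}$, and $\mathcal A_r$ consists of all facts over $\Sigma$ with arguments among $*$ and the $c_y$; - $\chi_{\mathsf i}$: $\theta(y)=c_y$, $\mathcal A_0=\{A(c_A^1,\dots,c_A^k)\mid A\in\Sigma\}$, and $\mathcal A_r$ consists of $\bot$ and all $B(c_A^1,\dots,c_A^k)$ with $A\ne B$ in $\Sigma$ of the same arity $k$; - $\chi_{\mathsf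 c}$: $\theta$ and $\mathcal A_0$ as in $\chi_{\mathsf i}$, and $\mathcal A_r$ consists of $\bot$ and all $B(c_A^1,\dots,c_A^k)$ with $A\in\Sigma$, $B\in\mathrm{sig}(\mathcal T)$, $A\neq B$, of the same arity $k$. **Theorem.** Let $L$ be a class of TBoxes. 1. If there is a non-negative integer $m$ such that every rule of every TBox in $L$ has at most $m$ distinct universally quantified variables, then the following problem is solvable in polynomial time: given $z\in\{\mathsf q,\mathsf f,\mathsf i,\mathsf c\}$, a TBox $\mathcal T\in L$, a signature $\Sigma$ over $\mathcal T$ and a rule $r\in\mathcal T$, decide whether $r\in\mathcal M^{\chi_z}$. 2. Without any restriction on $L$, the same problem for $z=\mathsf m$ is solvable in polynomial time. Here time is measured in the size of the input $(z,\mathcal T,\Sigma,r)$. The algorithm may depend on $L$ and $m$, and its answer matters only on inputs with $\mathcal T\in L$. -/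

import Mathlib

namespace ModuleExtraction

/-! ## Rules, TBoxes, signatures -/

/-- Predicate names: falsehood, truth, and a countable supply of further names. Equality is one of
the further names: a TBox that mentions it has its axiomatisation among its rules. -/
inductive PredName where
  | bot
  | top
  | sym (n : ℕ)
  deriving DecidableEq

/-- A predicate: a name together with an arity. -/
structure Pred where
  name : PredName
  arity : ℕ
  deriving DecidableEq

/-- The nullary falsehood predicate. -/
def Pred.falsum : Pred := ⟨.bot, 0⟩

/-- Function-free atoms whose arguments are taken from `τ` (variables, constants, or both). -/
structure Atom (τ : Type) where
  name : PredName
  args : List τ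
  deriving DecidableEq

/-- The predicate of an atom. -/
def Atom.pred {τ : Type} (a : Atom τ) : Pred := ⟨a.name, a.args.length⟩

/-- Replace the arguments of an atom. -/
def Atom.map {τ υ : Type} (g : τ → υ) (a : Atom τ) : Atom υ := ⟨a.name, a.args.map g⟩

/-- Variables. -/
abbrev Var := ℕ

/-- A constant-free rule `φ(x) → ∃ y, ψ₁(x, y) ∨ ⋯ ∨ ψₙ(x, y)`: `body` lists the atoms of `φ` and
`head` lists the conjunctions `ψᵢ`, each a list of atoms. The variables of the body are
quantified universally, all other variables of the head existentially, so that rules are safe. -/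
structure Rule where
  body : List (Atom Var)
  head : List (List (Atom Var))
  deriving DecidableEq

/-- The universally quantified variables of a rule. -/
def Rule.univVars (r : Rule) : Finset Var := (r.body.flatMap Atom.args).toFinset

/-- The existentially quantified variables of a rule. -/
def Rule.exVars (r : Rule) : Finset Var :=
  (r.head.flatten.flatMap Atom.args).toFinset \ r.univVars

/-- Syntactic conditions on rules: conjunctions have distinct atoms, falsehood (a nullary predicate)
does not occur in the body, truth does not occur in the head (in particular, no disjunct is the
empty conjunction). The head may be empty (`n = 0`). -/
structure Rule.WellFormed (r : Rule) : Prop where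
  body_nodup : r.body.Nodup
  head_nodup : ∀ ψ ∈ r.head, ψ.Nodup
  head_nonempty : ∀ ψ ∈ r.head, ψ ≠ []
  body_no_bot : ∀ a ∈ r.body, a.name ≠ .bot
  head_no_top : ∀ ψ ∈ r.head, ∀ a ∈ ψ, a.name ≠ .top
  bot_nullary : ∀ ψ ∈ r.head, ∀ a ∈ ψ, a.name = .bot → a.args = []

/-- Finite sets of rules. -/
abbrev TBox := Finset Rule

/-- The existentially quantified variables of a TBox. -/
def TBox.exVars (T : TBox) : Set Var := {y | ∃ r ∈ T, y ∈ r.exVars}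

/-- The signature of a TBox: the predicates of its atoms. -/
def TBox.sig (T : TBox) : Set Pred :=
  {p | ∃ r ∈ T, (∃ a ∈ r.body, a.pred = p) ∨ ∃ ψ ∈ r.head, ∃ a ∈ ψ, a.pred = p}

/-- Every rule is well formed, and distinct rules share no existentially quantified variables. -/
structure TBox.WellFormed (T : TBox) : Prop where
  rules : ∀ r ∈ T, r.WellFormed
  exVars_disjoint : ∀ r ∈ T, ∀ r' ∈ T, r ≠ r' → Disjoint r.exVars r'.exVars

/-- `S` is a signature over `T`. Falsehood belongs to every signature. -/
structure IsSignature (T : TBox) (S : Finset Pred) : Prop where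
  falsum_mem : Pred.falsum ∈ S
  subset_sig : ∀ p ∈ S, p = Pred.falsum ∨ p ∈ T.sig

/-! ## Datalog -/

/-- The constants `∗`, `c_y` (for a variable `y`) and `c_A^i` (for a predicate `A`). They are
pairwise distinct, and they are fresh because rules contain no constants. -/
inductive Const where
  | star
  | ex (y : Var)
  | crit (A : Pred) (i : ℕ)
  deriving DecidableEq

/-- Facts, that is, function-free ground atoms. -/
abbrev Fact := Atom Const

/-- The fact `⊥`. -/
def Fact.falsum : Fact := ⟨.bot, []⟩

/-- Datalog rules; the variables of `body` are quantified universally. The bodies that occur here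
have no constants. -/
structure DatalogRule where
  body : List (Atom Var)
  head : Atom (Var ⊕ Const)

/-- Forward-chaining proofs of a fact in a datalog program `P` and an ABox `A`. A node that is not a
leaf carries the rule that is applied there and has one child per body atom of that rule. Facts
over the truth predicate hold trivially. -/
inductive DatalogProof (P : Set DatalogRule) (A : Set Fact) : Fact → Type where
  | leaf (F : Fact) (hF : F ∈ A) : DatalogProof P A F
  | truth (F : Fact) (hF : F.name = .top) : DatalogProof P A F
  | node (d : DatalogRule) (hd : d ∈ P) (σ : Var → Const)
      (children : ∀ i : Fin d.body.length, DatalogProof P A ((d.body.get i).map σ)) :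
      DatalogProof P A (d.head.map (Sum.elim σ id))

/-- The rules that occur in a proof. -/
def DatalogProof.rules {P : Set DatalogRule} {A : Set Fact} :
    {F : Fact} → DatalogProof P A F → Set DatalogRule
  | _, .leaf _ _ => ∅
  | _, .truth _ _ => ∅
  | _, .node d _ _ children => {d} ∪ ⋃ i, (children i).rules

/-- The support of a fact: the rules that occur in some proof of it. -/
def factSupport (P : Set DatalogRule) (A : Set Fact) (F : Fact) : Set DatalogRule :=
  {d | ∃ ρ : DatalogProof P A F, d ∈ ρ.rules}

/-! ## Module settings and modules -/

/-- Module settings `⟨θ, A₀, Aᵣ⟩`. Of `θ` only the values at existentially quantified variables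
are used. -/
structure Setting where
  θ : Var → Const
  A₀ : Set Fact
  Aᵣ : Set Fact

/-- The atom of a datalog head that stems from an atom in the head of `r`: the substitution `θ` is
applied to the existentially quantified variables. -/
def Rule.skolem (r : Rule) (θ : Var → Const) (a : Atom Var) : Atom (Var ⊕ Const) :=
  a.map fun x => if x ∈ r.univVars then Sum.inl x else Sum.inr (θ x)

/-- The datalog rules that correspond to a rule: `φ → ⊥` if the head is empty, and otherwise all
`φ → γθ` for an atom `γ` of the head. -/
def Rule.datalog (r : Rule) (θ : Var → Const) : Set DatalogRule :=
  {d | (r.head = [] ∧ d = ⟨r.body, ⟨.bot, []⟩⟩) ∨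
    ∃ ψ ∈ r.head, ∃ a ∈ ψ, d = ⟨r.body, r.skolem θ a⟩}

/-- The program of a setting. -/
def Setting.program (χ : Setting) (T : TBox) : Set DatalogRule :=
  {d | ∃ r ∈ T, d ∈ r.datalog χ.θ}

/-- The support of a setting. -/
def Setting.support (χ : Setting) (T : TBox) : Set DatalogRule :=
  {d | d ∈ χ.program T ∧ ∃ F ∈ χ.Aᵣ, d ∈ factSupport (χ.program T) χ.A₀ F}

/-- The module of a setting. -/
def Setting.extract (χ : Setting) (T : TBox) : Set Rule :=
  {r | r ∈ T ∧ ∃ d ∈ r.datalog χ.θ, d ∈ χ.support T}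

/-- Names of the inseparability relations: model, query, fact, implication, classification. -/
inductive Insep where
  | m | q | f | i | c
  deriving DecidableEq

/-- The fact `B(c_A^1, …, c_A^n)`, with `n` the arity of `A`. -/
def critFact (A B : Pred) : Fact := ⟨B.name, (List.range A.arity).map (Const.crit A)⟩

/-- The facts `A(∗, …, ∗)` with `A` in `S`. -/
def starFacts (S : Finset Pred) : Set Fact :=
  {F | ∃ A ∈ S, F = ⟨A.name, List.replicate A.arity Const.star⟩}

/-- The facts `A(c_A^1, …, c_A^n)` with `A` in `S`. -/
def initFacts (S : Finset Pred) : Set Fact := {F | ∃ A ∈ S, F = critFact A A}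

/-- The settings `χ_z`. In the settings for implications and classification, falsehood is always a
relevant fact: it is what has to be proved for the implications `A(x) → ⊥`. -/
def setting (T : TBox) (S : Finset Pred) : Insep → Setting
  | .m => ⟨fun _ => Const.star, starFacts S, starFacts S⟩
  | .f => ⟨Const.ex, starFacts S, starFacts S⟩
  | .q => ⟨Const.ex, starFacts S,
      {F | F.pred ∈ S ∧ ∀ a ∈ F.args, a = Const.star ∨ ∃ y ∈ T.exVars, a = Const.ex y}⟩
  | .i => ⟨Const.ex, initFacts S,
      {F | F = Fact.falsum ∨
        ∃ A ∈ S, ∃ B ∈ S, A ≠ B ∧ A.arity = B.arity ∧ F = critFact A B}⟩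
  | .c => ⟨Const.ex, initFacts S,
      {F | F = Fact.falsum ∨
        ∃ A ∈ S, ∃ B ∈ T.sig, A ≠ B ∧ A.arity = B.arity ∧ F = critFact A B}⟩

/-- The module of `T` for the setting `χ_z` and the signature `S`. -/
def moduleOf (z : Insep) (T : TBox) (S : Finset Pred) : Set Rule := (setting T S z).extract T

/-! ## Polynomial time

The machine model is the usual WHILE language over binary trees (LISP lists over one atom), whose
polynomial-time decidable problems are those of Turing machines. A program has finitely many
registers, each pointing to a tree; the elementary operations are reading a register, `nil`, `cons`,
head, tail and a test for `nil`, each of which takes a constant number of pointer operations and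
counts as one step. (Trees are shared, so copying a pointer does not copy a tree; there is no
comparison of trees other than by inspecting them node by node.) -/

/-- Binary trees. -/
inductive Tree where
  | nil
  | cons (l r : Tree)

/-- The number of nodes, which is the size of an input. -/
def Tree.size : Tree → ℕ
  | .nil => 1
  | .cons l r => l.size + r.size + 1

/-- The left subtree (`nil` for `nil`). -/
def Tree.hd : Tree → Tree
  | .nil => .nil
  | .cons l _ => l

/-- The right subtree (`nil` for `nil`). -/
def Tree.tl : Tree → Tree
  | .nil => .nil
  | .cons _ r => r

/-- Contents of the registers. -/
abbrev Store := ℕ → Tree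

/-- Expressions. -/
inductive Exp where
  | reg (x : ℕ)
  | nil
  | cons (e₁ e₂ : Exp)
  | hd (e : Exp)
  | tl (e : Exp)

/-- The value of an expression. -/
def Exp.eval (s : Store) : Exp → Tree
  | .reg x => s x
  | .nil => .nil
  | .cons e₁ e₂ => .cons (e₁.eval s) (e₂.eval s)
  | .hd e => (e.eval s).hd
  | .tl e => (e.eval s).tl

/-- The number of elementary operations in the evaluation of an expression. -/
def Exp.cost : Exp → ℕ
  | .reg _ => 1
  | .nil => 1
  | .cons e₁ e₂ => e₁.cost + e₂.cost + 1
  | .hd e => e.cost + 1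
  | .tl e => e.cost + 1

/-- Programs. -/
inductive Prog where
  | assign (x : ℕ) (e : Exp)
  | seq (c₁ c₂ : Prog)
  | cond (e : Exp) (c₁ c₂ : Prog)
  | loop (e : Exp) (c : Prog)

/-- `Exec c s s' t`: started on the store `s`, the program `c` halts with the store `s'` after `t`
steps. The test of a conditional or a loop succeeds if the value is not `nil`. -/
inductive Exec : Prog → Store → Store → ℕ → Prop where
  | assign (x : ℕ) (e : Exp) (s : Store) :
      Exec (.assign x e) s (Function.update s x (e.eval s)) (e.cost + 1)
  | seq {c₁ c₂ : Prog} {s s₁ s₂ : Store} {t₁ t₂ : ℕ} :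
      Exec c₁ s s₁ t₁ → Exec c₂ s₁ s₂ t₂ → Exec (.seq c₁ c₂) s s₂ (t₁ + t₂ + 1)
  | cond_true {e : Exp} {c₁ c₂ : Prog} {s s₁ : Store} {t : ℕ} :
      e.eval s ≠ .nil → Exec c₁ s s₁ t → Exec (.cond e c₁ c₂) s s₁ (e.cost + t + 1)
  | cond_false {e : Exp} {c₁ c₂ : Prog} {s s₁ : Store} {t : ℕ} :
      e.eval s = .nil → Exec c₂ s s₁ t → Exec (.cond e c₁ c₂) s s₁ (e.cost + t + 1)
  | loop_done {e : Exp} {c : Prog} {s : Store} :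
      e.eval s = .nil → Exec (.loop e c) s s (e.cost + 1)
  | loop_step {e : Exp} {c : Prog} {s s₁ s₂ : Store} {t₁ t₂ : ℕ} :
      e.eval s ≠ .nil → Exec c s s₁ t₁ → Exec (.loop e c) s₁ s₂ t₂ →
      Exec (.loop e c) s s₂ (e.cost + t₁ + t₂ + 1)

/-- The initial store: the input is in register `0`, and all other registers are `nil`. -/
def initStore (w : Tree) : Store := Function.update (fun _ => Tree.nil) 0 w

/-- The problem of deciding `Q` on the inputs from `D`, given through the encoding `enc`, is solvable
in polynomial time: one program halts on every input from `D` within a number of steps that is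
polynomial in the size of the encoded input, and then register `0` is not `nil` if and only if the
answer is yes. -/
def PolyTimeDecidableOn {α : Type} (enc : α → Tree) (D : Set α) (Q : α → Prop) : Prop :=
  ∃ (c : Prog) (p : Polynomial ℕ), ∀ a ∈ D, ∃ (s : Store) (t : ℕ),
    Exec c (initStore (enc a)) s t ∧ t ≤ p.eval (enc a).size ∧ (s 0 ≠ Tree.nil ↔ Q a)

/-! ## Encoding of the inputs -/

/-- Lists are encoded as right combs. -/
def encList {α : Type} (enc : α → Tree) : List α → Tree
  | [] => .nil
  | a :: l => .cons (enc a) (encList enc l)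

/-- Bits. -/
def encBool : Bool → Tree
  | false => .nil
  | true => .cons .nil .nil

/-- Numbers that serve as names are written in binary, least significant bit first. -/
def encNat (n : ℕ) : Tree := encList encBool n.bits

/-- Predicate names. -/
def encPredName : PredName → Tree
  | .bot => .nil
  | .top => .cons .nil .nil
  | .sym n => .cons (.cons .nil .nil) (encNat n)

/-- A predicate is written as its name and a list of dummies in place of its arguments. -/
def encPred (p : Pred) : Tree :=
  .cons (encPredName p.name) (encList id (List.replicate p.arity Tree.nil))

/-- Atoms. -/
def encAtom (a : Atom Var) : Tree := .cons (encPredName a.name) (encList encNat a.args)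

/-- Rules. -/
def encRule (r : Rule) : Tree :=
  .cons (encList encAtom r.body) (encList (encList encAtom) r.head)

/-- The five names `z`. -/
def encInsep : Insep → Tree
  | .m => .nil
  | .q => .cons .nil .nil
  | .f => .cons .nil (.cons .nil .nil)
  | .i => .cons (.cons .nil .nil) .nil
  | .c => .cons (.cons .nil .nil) (.cons .nil .nil)

/-- An input of the module membership problem: `z`, a TBox and a signature (both listed in any
order), and a rule. -/
structure Input where
  z : Insep
  rules : List Rule
  preds : List Pred
  axm : Rule

/-- The TBox of an input. -/
def Input.tbox (I : Input) : TBox := I.rules.toFinset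

/-- The signature of an input. -/
def Input.sig (I : Input) : Finset Pred := I.preds.toFinset

/-- Encoding of inputs. -/
def Input.enc (I : Input) : Tree :=
  .cons (encInsep I.z) (.cons (encList encRule I.rules)
    (.cons (encList encPred I.preds) (encRule I.axm)))

/-- The inputs with `z` in `Z`, a TBox `T` from `L`, a signature over `T`, and a rule of `T`. -/
def inputs (Z : Set Insep) (L : Set TBox) : Set Input :=
  {I | I.z ∈ Z ∧ I.tbox ∈ L ∧ IsSignature I.tbox I.sig ∧ I.axm ∈ I.tbox}

/-- The rule of the input belongs to the module of its TBox for `χ_z` and its signature. -/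
def Input.InModule (I : Input) : Prop := I.axm ∈ moduleOf I.z I.tbox I.sig

end ModuleExtraction

namespace ModuleExtraction

/-! ## Polynomial-time functions between encoded types -/

/-! The algorithm grounds the datalog program over the finitely many constants that matter (`∗`, the
`c_y`, and the `c_A^i` with `A` in the signature). If rules have at most `m` universal variables,
assignments of constants to these variables can be listed as lists of at most `m` pairs, so for
fixed `m` there are polynomially many ground instances. For `z = m` the single constant `∗`
suffices, and with it the single empty assignment, whatever the number of variables.

On this list of instances two least fixed points are computed. `Input.active` works forwards: an
instance is kept if all its body facts are derivable. `Input.useful` works backwards inside it: an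
instance is kept if its head is relevant, or is a body fact of a kept instance. A rule belongs to
the module iff one of its instances is kept.

Soundness (`useful_sound`, `inModule_of_answer`): any proof of the head of a useful instance can be
grafted into a proof of a relevant fact, so the rules in it are in the support. Completeness
(`IsRetraction.exists_useful`): an arbitrary proof is mapped through a retraction of all constants
onto those considered, and its nodes become useful instances when it is read from the root down.

For the time bound, `PolyFun` is a class of functions closed under composition, pairing, case
distinction, bounded folds and equality tests. The algorithm is composed from these operations, so
`PolyFun.answer` follows structurally. -/

theorem eval_mono (p : Polynomial ℕ) : Monotone fun n => p.eval n := by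
  intro a b hab
  induction p using Polynomial.induction_on' with
  | add p q hp hq => simpa only [Polynomial.eval_add] using add_le_add hp hq
  | monomial n c =>
    simp only [Polynomial.eval_monomial]
    exact Nat.mul_le_mul_left _ (Nat.pow_le_pow_left hab n)

/-- Types whose elements are encoded as trees. -/
class Enc (α : Type) where
  enc : α → Tree
  inj : Function.Injective enc

open Enc

theorem one_le_size (w : Tree) : 1 ≤ w.size := by
  cases w <;> simp [Tree.size]

theorem encList_injective {α : Type} {e : α → Tree} (he : Function.Injective e) :
    Function.Injective (encList e) := by
  intro l
  induction l with
  | nil => rintro (_ | ⟨b, l'⟩) h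
           · rfl
           · simp [encList] at h
  | cons a l ih => rintro (_ | ⟨b, l'⟩) h
                   · simp [encList] at h
                   · simp only [encList, Tree.cons.injEq] at h
                     rw [he h.1, ih h.2]

instance : Enc Tree := ⟨id, fun _ _ h => h⟩

instance : Enc Unit := ⟨fun _ => .nil, fun _ _ _ => rfl⟩

instance : Enc Bool := ⟨encBool, by rintro (_ | _) (_ | _) h <;> simp_all [encBool]⟩

instance {α β : Type} [Enc α] [Enc β] : Enc (α × β) :=
  ⟨fun p => .cons (enc p.1) (enc p.2), fun p q h => by
    simp only [Tree.cons.injEq] at h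
    exact Prod.ext (inj h.1) (inj h.2)⟩

instance {α : Type} [Enc α] : Enc (List α) := ⟨encList enc, encList_injective inj⟩

section

variable {α β γ δ : Type} [Enc α] [Enc β] [Enc γ] [Enc δ]

theorem enc_tree (w : Tree) : enc w = w := rfl
theorem enc_pair (a : α) (b : β) : enc (a, b) = .cons (enc a) (enc b) := rfl
theorem enc_nil : enc ([] : List α) = .nil := rfl
theorem enc_cons (a : α) (l : List α) : enc (a :: l) = .cons (enc a) (enc l) := rfl
theorem enc_true : enc true = .cons .nil .nil := rfl
theorem enc_false : enc false = .nil := rfl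

/-- `f` is computed in polynomial time and has values of polynomial size. For every register `b`,
some program replaces an argument in register `b` by the value and leaves all lower registers
unchanged. -/
@[fun_prop]
structure PolyFun (f : α → β) : Prop where
  size : ∃ q : Polynomial ℕ, ∀ a, (enc (f a)).size ≤ q.eval (enc a).size
  prog : ∀ b : ℕ, ∃ (c : Prog) (p : Polynomial ℕ), ∀ (a : α) (s : Store), s b = enc a →
    ∃ (s' : Store) (t : ℕ), Exec c s s' t ∧ t ≤ p.eval (enc a).size ∧ s' b = enc (f a) ∧
      ∀ i < b, s' i = s i

namespace PolyFun

/-- A function that acts on encodings like a polynomial-time function. -/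
theorem of_enc {f : α → β} {g : γ → δ} (hg : PolyFun g) (i : α → γ)
    (hi : ∀ a, enc (i a) = enc a) (h : ∀ a, enc (f a) = enc (g (i a))) : PolyFun f := by
  constructor
  · obtain ⟨q, hq⟩ := hg.size
    refine ⟨q, fun a => ?_⟩
    rw [h, ← hi]
    exact hq _
  · intro b
    obtain ⟨c, p, hc⟩ := hg.prog b
    refine ⟨c, p, fun a s hs => ?_⟩
    rw [h, ← hi]
    exact hc _ s (by rw [hs, hi])

/-- The tree denoted by an expression in the argument register. -/
theorem of_exp {f : α → β} (e : Exp) (h : ∀ a, e.eval (fun _ => enc a) = enc (f a))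
    (hsize : ∀ a, (enc (f a)).size ≤ (enc a).size) : PolyFun f := by
  refine ⟨⟨Polynomial.X, by simpa using hsize⟩, fun b => ?_⟩
  -- The hypothesis on `e` concerns a constant store, so every register in it may be renamed to `b`.
  have key : ∃ e' : Exp, ∀ s : Store, e'.eval s = e.eval (fun _ => s b) := by
    clear h
    induction e with
    | reg x => exact ⟨.reg b, fun s => rfl⟩
    | nil => exact ⟨.nil, fun s => rfl⟩
    | cons e₁ e₂ h₁ h₂ =>
      obtain ⟨e₁', h₁⟩ := h₁
      obtain ⟨e₂', h₂⟩ := h₂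
      exact ⟨.cons e₁' e₂', fun s => by simp [Exp.eval, h₁, h₂]⟩
    | hd e h =>
      obtain ⟨e', h⟩ := h
      exact ⟨.hd e', fun s => by simp [Exp.eval, h]⟩
    | tl e h =>
      obtain ⟨e', h⟩ := h
      exact ⟨.tl e', fun s => by simp [Exp.eval, h]⟩
  obtain ⟨e', he'⟩ := key
  refine ⟨.assign b e', Polynomial.C (e'.cost + 1), fun a s hs =>
    ⟨_, _, Exec.assign b e' s, by simp, ?_, fun i hi => ?_⟩⟩
  · simp [he', hs, h]
  · simp [Function.update_of_ne hi.ne]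

@[fun_prop]
theorem id : PolyFun fun a : α => a :=
  of_exp (.reg 0) (fun _ => rfl) fun _ => le_rfl

theorem exists_const (w : Tree) : ∃ e : Exp, ∀ s, e.eval s = w := by
  induction w with
  | nil => exact ⟨.nil, fun s => rfl⟩
  | cons l r hl hr =>
    obtain ⟨e₁, h₁⟩ := hl
    obtain ⟨e₂, h₂⟩ := hr
    exact ⟨.cons e₁ e₂, fun s => by simp [Exp.eval, h₁, h₂]⟩

@[fun_prop]
theorem const (b : β) : PolyFun fun _ : α => b := by
  obtain ⟨e, he⟩ := exists_const (enc b)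
  refine ⟨⟨Polynomial.C (enc b).size, by simp⟩, fun x => ⟨.assign x e, Polynomial.C (e.cost + 1),
    fun a s hs => ⟨_, _, Exec.assign x e s, by simp, by simp [he], fun i hi => ?_⟩⟩⟩
  simp [Function.update_of_ne hi.ne]

@[fun_prop]
-- The size bound on `f` is what makes the running time of `g` on `f a` polynomial in the size of
-- `a`.
theorem comp {g : β → γ} {f : α → β} (hg : PolyFun g) (hf : PolyFun f) :
    PolyFun fun a => g (f a) := by
  obtain ⟨q, hq⟩ := hf.size
  refine ⟨?_, fun b => ?_⟩
  · obtain ⟨q', hq'⟩ := hg.size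
    refine ⟨q'.comp q, fun a => (hq' _).trans ?_⟩
    rw [Polynomial.eval_comp]
    exact eval_mono q' (hq a)
  · obtain ⟨c, p, hc⟩ := hf.prog b
    obtain ⟨c', p', hc'⟩ := hg.prog b
    refine ⟨.seq c c', p + p'.comp q + 1, fun a s hs => ?_⟩
    obtain ⟨s₁, t₁, e₁, ht₁, hb₁, hi₁⟩ := hc a s hs
    obtain ⟨s₂, t₂, e₂, ht₂, hb₂, hi₂⟩ := hc' (f a) s₁ hb₁
    refine ⟨s₂, _, e₁.seq e₂, ?_, hb₂, fun i hi => (hi₂ i hi).trans (hi₁ i hi)⟩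
    have := eval_mono p' (hq a)
    simp only [Polynomial.eval_add, Polynomial.eval_comp, Polynomial.eval_one] at this ⊢
    omega

@[fun_prop]
-- Registers above `b` are scratch space. The second program runs in `b + 2`, hence preserves the
-- first result in `b + 1`; the first one preserves the argument in `b`.
theorem pair {f : α → β} {g : α → γ} (hf : PolyFun f) (hg : PolyFun g) :
    PolyFun fun a => (f a, g a) := by
  refine ⟨?_, fun b => ?_⟩
  · obtain ⟨q, hq⟩ := hf.size
    obtain ⟨q', hq'⟩ := hg.size
    refine ⟨q + q' + 1, fun a => ?_⟩
    have := hq a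
    have := hq' a
    simp only [Polynomial.eval_add, Polynomial.eval_one, enc_pair, Tree.size]
    omega
  · obtain ⟨c, p, hc⟩ := hf.prog (b + 1)
    obtain ⟨c', p', hc'⟩ := hg.prog (b + 2)
    refine ⟨.seq (.assign (b + 1) (.reg b)) (.seq c (.seq (.assign (b + 2) (.reg b))
      (.seq c' (.assign b (.cons (.reg (b + 1)) (.reg (b + 2))))))), p + p' + 12, fun a s hs => ?_⟩
    obtain ⟨s₁, t₁, e₁, ht₁, hb₁, hi₁⟩ :=
      hc a (Function.update s (b + 1) (s b)) (by simp [hs])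
    have hb : s₁ b = enc a := by
      rw [hi₁ b (by omega), Function.update_of_ne (by omega), hs]
    obtain ⟨s₂, t₂, e₂, ht₂, hb₂, hi₂⟩ :=
      hc' a (Function.update s₁ (b + 2) (s₁ b)) (by simp [hb])
    refine ⟨_, _, .seq (.assign _ _ _) (.seq e₁ (.seq (.assign _ _ _) (.seq e₂
      (.assign _ _ _)))), ?_, ?_, fun i hi => ?_⟩
    · simp only [Polynomial.eval_add, Polynomial.eval_ofNat, Exp.cost]
      omega
    · simp only [Exp.eval, Function.update_self, enc_pair]
      rw [hb₂, hi₂ (b + 1) (by omega), Function.update_of_ne (by omega), hb₁]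
    · rw [Function.update_of_ne (by omega), hi₂ i (by omega), Function.update_of_ne (by omega),
        hi₁ i (by omega), Function.update_of_ne (by omega)]

@[fun_prop]
theorem fst {f : α → β × γ} (hf : PolyFun f) : PolyFun fun a => (f a).1 :=
  comp (g := Prod.fst) (of_exp (.hd (.reg 0)) (fun _ => rfl) fun p => by
    change _ ≤ (enc p.1).size + (enc p.2).size + 1
    omega) hf

@[fun_prop]
theorem snd {f : α → β × γ} (hf : PolyFun f) : PolyFun fun a => (f a).2 :=
  comp (g := Prod.snd) (of_exp (.tl (.reg 0)) (fun _ => rfl) fun p => by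
    change _ ≤ (enc p.1).size + (enc p.2).size + 1
    omega) hf

@[fun_prop]
theorem cons {f : α → β} {g : α → List β} (hf : PolyFun f) (hg : PolyFun g) :
    PolyFun fun a => f a :: g a :=
  of_enc (hf.pair hg) (fun a => a) (fun _ => rfl) fun _ => rfl

@[fun_prop]
theorem hd {f : α → Tree} (hf : PolyFun f) : PolyFun fun a => (f a).hd :=
  comp (g := Tree.hd) (of_exp (.hd (.reg 0)) (fun _ => rfl) fun w => by
    cases w
    · exact le_rfl
    · simp only [enc_tree, Tree.size, Tree.hd]
      omega) hf

@[fun_prop]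
theorem tl {f : α → Tree} (hf : PolyFun f) : PolyFun fun a => (f a).tl :=
  comp (g := Tree.tl) (of_exp (.tl (.reg 0)) (fun _ => rfl) fun w => by
    cases w
    · exact le_rfl
    · simp only [enc_tree, Tree.size, Tree.tl]
      omega) hf

/-- Case distinction on whether an encoding is `nil`. -/
theorem branch {k : α → β} {f g r : α → γ} (hk : PolyFun k) (hf : PolyFun f) (hg : PolyFun g)
    (h₁ : ∀ a, enc (k a) ≠ .nil → r a = f a) (h₂ : ∀ a, enc (k a) = .nil → r a = g a) :
    PolyFun r := by
  refine ⟨?_, fun b => ?_⟩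
  · obtain ⟨q, hq⟩ := hf.size
    obtain ⟨q', hq'⟩ := hg.size
    refine ⟨q + q', fun a => ?_⟩
    have := hq a
    have := hq' a
    rw [Polynomial.eval_add]
    by_cases h : enc (k a) = .nil
    · rw [h₂ a h]
      omega
    · rw [h₁ a h]
      omega
  · obtain ⟨c, p, hc⟩ := hk.prog (b + 1)
    obtain ⟨c₁, p₁, hc₁⟩ := hf.prog b
    obtain ⟨c₂, p₂, hc₂⟩ := hg.prog b
    refine ⟨.seq (.assign (b + 1) (.reg b)) (.seq c (.cond (.reg (b + 1)) c₁ c₂)),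
      p + p₁ + p₂ + 8, fun a s hs => ?_⟩
    obtain ⟨s₁, t₁, e₁, ht₁, hb₁, hi₁⟩ :=
      hc a (Function.update s (b + 1) (s b)) (by simp [hs])
    have hlow : ∀ i ≤ b, s₁ i = s i := fun i hi => by
      rw [hi₁ i (by omega), Function.update_of_ne (by omega)]
    have hb : s₁ b = enc a := by rw [hlow b le_rfl, hs]
    by_cases h : enc (k a) = .nil
    · obtain ⟨s₂, t₂, e₂, ht₂, hb₂, hi₂⟩ := hc₂ a s₁ hb
      refine ⟨_, _, .seq (.assign _ _ _) (.seq e₁ (.cond_false (by simpa [Exp.eval, hb₁] using h)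
        e₂)), ?_, by rw [hb₂, h₂ a h], fun i hi => by rw [hi₂ i hi, hlow i hi.le]⟩
      simp only [Polynomial.eval_add, Polynomial.eval_ofNat, Exp.cost]
      omega
    · obtain ⟨s₂, t₂, e₂, ht₂, hb₂, hi₂⟩ := hc₁ a s₁ hb
      refine ⟨_, _, .seq (.assign _ _ _) (.seq e₁ (.cond_true (by simpa [Exp.eval, hb₁] using h)
        e₂)), ?_, by rw [hb₂, h₁ a h], fun i hi => by rw [hi₂ i hi, hlow i hi.le]⟩
      simp only [Polynomial.eval_add, Polynomial.eval_ofNat, Exp.cost]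
      omega

@[fun_prop]
theorem cond {k : α → Bool} {f g : α → γ} (hk : PolyFun k) (hf : PolyFun f) (hg : PolyFun g) :
    PolyFun fun a => bif k a then f a else g a :=
  branch hk hf hg
    (fun a h => by
      cases hka : k a
      · rw [hka] at h
        exact absurd enc_false h
      · rfl)
    (fun a h => by
      cases hka : k a
      · rfl
      · rw [hka, enc_true] at h
        cases h)

@[fun_prop]
theorem and {f g : α → Bool} (hf : PolyFun f) (hg : PolyFun g) : PolyFun fun a => f a && g a := by
  convert hf.cond hg (const false) using 2 with a
  cases f a <;> rfl

@[fun_prop]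
theorem or {f g : α → Bool} (hf : PolyFun f) (hg : PolyFun g) : PolyFun fun a => f a || g a := by
  convert hf.cond (const true) hg using 2 with a
  cases f a <;> rfl

@[fun_prop]
theorem not {f : α → Bool} (hf : PolyFun f) : PolyFun fun a => !f a := by
  convert hf.cond (const false) (const true) using 2 with a
  cases f a <;> rfl

/-- This replaces pattern matching. Since `(a, x :: t)` and `(a, x, t)` have the same encoding, the
nonempty branch needs no unpacking: the argument is only paired with the list. -/
theorem list_cases {l : α → List β} {f : α → γ} {g : α → β → List β → γ} {r : α → γ}
    (hl : PolyFun l) (hf : PolyFun f)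
    (hg : PolyFun fun p : α × β × List β => g p.1 p.2.1 p.2.2)
    (h₁ : ∀ a, l a = [] → r a = f a) (h₂ : ∀ a b t, l a = b :: t → r a = g a b t) :
    PolyFun r := by
  refine ⟨?_, fun b => ?_⟩
  · obtain ⟨q, hq⟩ := hf.size
    obtain ⟨q', hq'⟩ := hg.size
    obtain ⟨q₀, hq₀⟩ := (PolyFun.id.pair hl).size
    refine ⟨q + q'.comp q₀, fun a => ?_⟩
    rw [Polynomial.eval_add, Polynomial.eval_comp]
    cases h : l a with
    | nil =>
      rw [h₁ a h]
      exact (hq a).trans (Nat.le_add_right _ _)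
    | cons x t =>
      rw [h₂ a x t h]
      have h' := hq₀ a
      rw [h] at h'
      exact (hq' (a, x, t)).trans ((eval_mono q' h').trans (Nat.le_add_left _ _))
  · obtain ⟨c, p, hc⟩ := hl.prog (b + 1)
    obtain ⟨c₁, p₁, hc₁⟩ := hg.prog b
    obtain ⟨c₂, p₂, hc₂⟩ := hf.prog b
    obtain ⟨q₀, hq₀⟩ := (PolyFun.id.pair hl).size
    refine ⟨.seq (.assign (b + 1) (.reg b)) (.seq c (.cond (.reg (b + 1))
      (.seq (.assign b (.cons (.reg b) (.reg (b + 1)))) c₁) c₂)),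
      p + p₁.comp q₀ + p₂ + 13, fun a s hs => ?_⟩
    obtain ⟨s₁, t₁, e₁, ht₁, hb₁, hi₁⟩ :=
      hc a (Function.update s (b + 1) (s b)) (by simp [hs])
    have hlow : ∀ i ≤ b, s₁ i = s i := fun i hi => by
      rw [hi₁ i (by omega), Function.update_of_ne (by omega)]
    have hb : s₁ b = enc a := by rw [hlow b le_rfl, hs]
    cases h : l a with
    | nil =>
      obtain ⟨s₂, t₂, e₂, ht₂, hb₂, hi₂⟩ := hc₂ a s₁ hb
      refine ⟨_, _, .seq (.assign _ _ _) (.seq e₁ (.cond_false (by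
        simp [Exp.eval, hb₁, h, enc_nil]) e₂)), ?_, by rw [hb₂, h₁ a h],
        fun i hi => by rw [hi₂ i hi, hlow i hi.le]⟩
      simp only [Polynomial.eval_add, Polynomial.eval_ofNat, Exp.cost]
      omega
    | cons x t =>
      obtain ⟨s₂, t₂, e₂, ht₂, hb₂, hi₂⟩ := hc₁ (a, x, t)
        (Function.update s₁ b (.cons (s₁ b) (s₁ (b + 1)))) (by
          rw [Function.update_self, hb, hb₁, h]
          rfl)
      refine ⟨_, _, .seq (.assign _ _ _) (.seq e₁ (.cond_true (by
        simp [Exp.eval, hb₁, h, enc_cons]) (.seq (.assign _ _ _) e₂))), ?_, by rw [hb₂, h₂ a x t h],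
        fun i hi => by rw [hi₂ i hi, Function.update_of_ne hi.ne, hlow i hi.le]⟩
      have h' := hq₀ a
      rw [h] at h'
      have h'' := eval_mono p₁ h'
      have h3 : (enc (a, x, t)).size = (enc (a, x :: t)).size := rfl
      rw [h3] at ht₂
      simp only [Polynomial.eval_add, Polynomial.eval_ofNat, Polynomial.eval_comp, Exp.cost]
      simp only at h''
      omega

/-- Loops: a state of two components is transformed until the encoding of the first is `nil`. -/
theorem while_loop {init : α → β × γ} {step : β × γ → β × γ} {f : α → γ}
    (hinit : PolyFun init) (hstep : PolyFun step) (N Q : Polynomial ℕ)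
    (h : ∀ a, ∃ n ≤ N.eval (enc a).size,
      (∀ k < n, enc (step^[k] (init a)).1 ≠ .nil) ∧ enc (step^[n] (init a)).1 = .nil ∧
      (∀ k ≤ n, (enc (step^[k] (init a))).size ≤ Q.eval (enc a).size) ∧
      (step^[n] (init a)).2 = f a) :
    PolyFun f := by
  refine ⟨⟨Q, fun a => ?_⟩, fun b => ?_⟩
  · obtain ⟨n, -, -, -, hQ, hf⟩ := h a
    rw [← hf]
    refine le_trans ?_ (hQ n le_rfl)
    change _ ≤ _ + (enc (step^[n] (init a)).2).size + 1
    omega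
  · obtain ⟨c, p, hc⟩ := hinit.prog b
    obtain ⟨c', p', hc'⟩ := hstep.prog b
    refine ⟨.seq c (.seq (.loop (.hd (.reg b)) c') (.assign b (.tl (.reg b)))),
      p + N * (p'.comp Q + 3) + 8, fun a s hs => ?_⟩
    obtain ⟨n, hn, hlt, hnil, hQ, hf⟩ := h a
    obtain ⟨s₁, t₁, e₁, ht₁, hb₁, hi₁⟩ := hc a s hs
    -- Induction on the number `j` of remaining rounds.
    have key : ∀ j k, k + j = n → ∀ s₁ : Store, s₁ b = enc (step^[k] (init a)) →
        ∃ s₂ t, Exec (.loop (.hd (.reg b)) c') s₁ s₂ t ∧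
          t ≤ j * (p'.eval (Q.eval (enc a).size) + 3) + 3 ∧
          s₂ b = enc (step^[n] (init a)) ∧ ∀ i < b, s₂ i = s₁ i := by
      intro j
      induction j with
      | zero =>
        rintro k rfl s₁ hs₁
        refine ⟨s₁, _, .loop_done ?_, by simp [Exp.cost], hs₁, fun _ _ => rfl⟩
        simp only [Exp.eval, hs₁]
        exact hnil
      | succ j ih =>
        intro k hk s₁ hs₁
        obtain ⟨s₂, t₂, e₂, ht₂, hb₂, hi₂⟩ := hc' _ s₁ hs₁
        rw [← Function.iterate_succ_apply' step] at hb₂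
        obtain ⟨s₃, t₃, e₃, ht₃, hb₃, hi₃⟩ := ih (k + 1) (by omega) s₂ hb₂
        refine ⟨s₃, _, .loop_step ?_ e₂ e₃, ?_, hb₃, fun i hi => by rw [hi₃ i hi, hi₂ i hi]⟩
        · simp only [Exp.eval, hs₁]
          exact hlt k (by omega)
        -- The uniform bound `Q` on all intermediate states gives each round the same time bound.
        · have := eval_mono p' (hQ k (by omega))
          simp only at this
          simp only [Exp.cost]
          rw [Nat.succ_mul]
          omega
    obtain ⟨s₂, t₂, e₂, ht₂, hb₂, hi₂⟩ := key n 0 (by omega) s₁ hb₁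
    refine ⟨_, _, .seq e₁ (.seq e₂ (.assign _ _ _)), ?_, ?_, fun i hi => ?_⟩
    · simp only [Polynomial.eval_add, Polynomial.eval_ofNat, Polynomial.eval_comp,
        Polynomial.eval_mul, Exp.cost]
      have := Nat.mul_le_mul_right (p'.eval (Q.eval (enc a).size) + 3) hn
      omega
    · rw [← hf]
      simp only [Exp.eval, Function.update_self, hb₂]
      rfl
    · rw [Function.update_of_ne hi.ne, hi₂ i hi, hi₁ i hi]

end PolyFun

end

/-! ### Sizes of encoded lists, and list operations. -/

section

variable {α β γ δ : Type} [Enc α] [Enc β] [Enc γ] [Enc δ]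

theorem size_pair (a : α) (b : β) : (enc (a, b)).size = (enc a).size + (enc b).size + 1 := rfl

theorem size_nil : (enc ([] : List α)).size = 1 := rfl

theorem size_cons (a : α) (l : List α) :
    (enc (a :: l)).size = (enc a).size + (enc l).size + 1 := rfl

theorem size_bool_le (x : Bool) : (enc x).size ≤ 3 := by
  cases x <;> decide

theorem size_append (l l' : List α) :
    (enc (l ++ l')).size + 1 = (enc l).size + (enc l').size := by
  induction l with
  | nil =>
    rw [List.nil_append, size_nil]
    omega
  | cons a l ih =>
    rw [List.cons_append, size_cons, size_cons]
    omega

theorem size_reverse (l : List α) : (enc l.reverse).size = (enc l).size := by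
  induction l with
  | nil => rfl
  | cons a l ih =>
    have := size_append l.reverse [a]
    rw [List.reverse_cons, size_cons]
    rw [size_cons, size_nil] at this
    omega

theorem length_le_size (l : List α) : l.length ≤ (enc l).size := by
  induction l with
  | nil => exact Nat.zero_le _
  | cons a l ih =>
    rw [size_cons, List.length_cons]
    omega

theorem size_le_of_mem {a : α} {l : List α} (h : a ∈ l) : (enc a).size ≤ (enc l).size := by
  induction l with
  | nil => cases h
  | cons b l ih =>
    rw [size_cons]
    rcases List.mem_cons.1 h with rfl | h
    · omega
    · have := ih h
      omega

theorem size_sublist {l l' : List α} (h : l.Sublist l') : (enc l).size ≤ (enc l').size := by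
  induction h with
  | slnil => exact le_rfl
  | cons a _ ih =>
    rw [size_cons]
    omega
  | cons_cons a _ ih =>
    rw [size_cons, size_cons]
    omega

theorem size_le_length_mul {l : List α} {n : ℕ} (h : ∀ a ∈ l, (enc a).size ≤ n) :
    (enc l).size ≤ l.length * (n + 1) + 1 := by
  induction l with
  | nil => simp [size_nil]
  | cons a l ih =>
    have h₁ := h a (by simp)
    have h₂ := ih fun b hb => h b (by simp [hb])
    rw [size_cons, List.length_cons, Nat.succ_mul]
    omega

namespace PolyFun

/-- The bound `Q` on all intermediate accumulators has to be assumed: iterating a step of polynomial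
growth can produce values of exponential size. The loop state holds the remaining list, which
controls the loop, the accumulator, and the parameter `a`. -/
theorem foldl {l : α → List β} {init : α → γ} {f : α → γ → β → γ} (hl : PolyFun l)
    (hinit : PolyFun init) (hf : PolyFun fun p : α × γ × β => f p.1 p.2.1 p.2.2)
    (Q : Polynomial ℕ)
    (hQ : ∀ a, ∀ l', l' <+: l a → (enc (l'.foldl (f a) (init a))).size ≤ Q.eval (enc a).size) :
    PolyFun fun a => (l a).foldl (f a) (init a) := by
  let step : List β × γ × α → List β × γ × α := fun s =>
    match s.1 with
    | [] => s
    | x :: t => (t, f s.2.2 s.2.1 x, s.2.2)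
  have hstep : PolyFun step := by
    refine list_cases (l := fun s => s.1) (f := fun s => s)
      (g := fun s x t => (t, f s.2.2 s.2.1 x, s.2.2)) (by fun_prop) (by fun_prop) ?_ ?_ ?_
    · exact pair (by fun_prop) (pair (hf.comp (f := fun p : (List β × γ × α) × β × List β =>
        (p.1.2.2, p.1.2.1, p.2.1)) (by fun_prop)) (by fun_prop))
    · rintro ⟨l, s⟩ (rfl : l = [])
      rfl
    · rintro ⟨l, s⟩ x t (rfl : l = x :: t)
      rfl
  have iter : ∀ a k, k ≤ (l a).length → step^[k] (l a, init a, a) =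
      ((l a).drop k, ((l a).take k).foldl (f a) (init a), a) := by
    intro a k
    induction k with
    | zero => simp
    | succ k ih =>
      intro hk
      have hd := List.drop_eq_getElem_cons (show k < (l a).length by omega)
      rw [Function.iterate_succ_apply', ih (by omega), List.take_add_one, List.foldl_append,
        List.getElem?_eq_getElem (show k < (l a).length by omega), hd]
      rfl
  obtain ⟨q, hq⟩ := hl.size
  suffices PolyFun fun a => ((l a).foldl (f a) (init a), a) from this.fst
  refine while_loop (init := fun a => (l a, init a, a)) (by fun_prop) hstep q
    (q + Q + Polynomial.X + 2) fun a => ⟨(l a).length, (length_le_size _).trans (hq a), ?_, ?_,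
      ?_, ?_⟩
  · intro k hk
    have hd := List.drop_eq_getElem_cons hk
    rw [iter a k hk.le, hd, enc_cons]
    exact Tree.noConfusion
  · rw [iter a _ le_rfl, List.drop_length, enc_nil]
  · intro k hk
    rw [iter a k hk, size_pair, size_pair]
    have h₁ := (size_sublist (List.drop_sublist k (l a))).trans (hq a)
    have h₂ := hQ a _ (List.take_prefix k (l a))
    simp only [Polynomial.eval_add, Polynomial.eval_X, Polynomial.eval_ofNat]
    omega
  · rw [iter a _ le_rfl, List.take_length]

@[fun_prop]
theorem reverse {l : α → List β} (hl : PolyFun l) : PolyFun fun a => (l a).reverse := by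
  have key : ∀ l acc : List β, l.foldl (fun acc x => x :: acc) acc = l.reverse ++ acc := by
    intro l
    induction l with
    | nil => simp
    | cons x l ih => simp [ih]
  obtain ⟨q, hq⟩ := hl.size
  convert foldl (f := fun _ acc x => x :: acc) hl (const ([] : List β)) (by fun_prop) q ?_ using 2
  · simp [key]
  · intro a l' hl'
    rw [key, List.append_nil, size_reverse]
    exact (size_sublist hl'.sublist).trans (hq a)

theorem foldr {l : α → List β} {init : α → γ} {f : α → β → γ → γ} (hl : PolyFun l)
    (hinit : PolyFun init) (hf : PolyFun fun p : α × β × γ => f p.1 p.2.1 p.2.2)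
    (Q : Polynomial ℕ)
    (hQ : ∀ a, ∀ l', l' <:+ l a → (enc (l'.foldr (f a) (init a))).size ≤ Q.eval (enc a).size) :
    PolyFun fun a => (l a).foldr (f a) (init a) := by
  have h := foldl (f := fun a c b => f a b c) hl.reverse hinit
    (hf.comp (f := fun p : α × γ × β => (p.1, p.2.2, p.2.1)) (by fun_prop)) Q fun a l' hl' => by
      have := hQ a l'.reverse (by
        rw [← List.reverse_reverse (l a)]
        exact List.reverse_suffix.2 hl')
      rwa [List.foldr_reverse] at this
  simpa only [List.foldl_reverse] using h

@[fun_prop]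
theorem map {l : α → List β} {f : α → β → γ} (hl : PolyFun l)
    (hf : PolyFun fun p : α × β => f p.1 p.2) : PolyFun fun a => (l a).map (f a) := by
  obtain ⟨q, hq⟩ := hl.size
  obtain ⟨q', hq'⟩ := hf.size
  convert foldr (f := fun a x acc => f a x :: acc) hl (const ([] : List γ))
    (cons (hf.comp (f := fun p : α × β × List γ => (p.1, p.2.1)) (by fun_prop)) (by fun_prop))
    (q * (q'.comp (Polynomial.X + q + 1) + 1) + 1) ?_ using 2 with a
  · induction l a with
    | nil => rfl
    | cons x l ih => rw [List.map_cons, ih, List.foldr_cons]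
  · intro a l' hl'
    have hmap : l'.foldr (fun x acc => f a x :: acc) [] = l'.map (f a) := by
      clear hl'
      induction l' with
      | nil => rfl
      | cons x l ih => rw [List.map_cons, ← ih, List.foldr_cons]
    rw [hmap]
    have hsz := (size_sublist hl'.sublist).trans (hq a)
    -- Each value has size at most `q'` of the size of a pair of `a` and a list element, and there
    -- are at most `q` values.
    refine (size_le_length_mul (n := q'.eval ((enc a).size + q.eval (enc a).size + 1)) ?_).trans ?_
    · intro c hc
      obtain ⟨x, hx, rfl⟩ := List.mem_map.1 hc
      refine (hq' (a, x)).trans (eval_mono q' ?_)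
      have := (size_le_of_mem hx).trans hsz
      rw [size_pair]
      omega
    · simp only [Polynomial.eval_add, Polynomial.eval_mul, Polynomial.eval_comp,
        Polynomial.eval_X, Polynomial.eval_one, List.length_map]
      gcongr
      exact (length_le_size l').trans hsz

@[fun_prop]
theorem filter {l : α → List β} {f : α → β → Bool} (hl : PolyFun l)
    (hf : PolyFun fun p : α × β => f p.1 p.2) : PolyFun fun a => (l a).filter (f a) := by
  have key : ∀ a (l : List β),
      l.filter (f a) = l.foldr (fun x acc => bif f a x then x :: acc else acc) [] := by
    intro a l
    induction l with
    | nil => rfl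
    | cons x l ih => cases h : f a x <;> simp [h, ih]
  obtain ⟨q, hq⟩ := hl.size
  convert foldr (f := fun a x acc => bif f a x then x :: acc else acc) hl (const ([] : List β))
    (cond (hf.comp (f := fun p : α × β × List β => (p.1, p.2.1)) (by fun_prop)) (by fun_prop)
      (by fun_prop)) q ?_ using 2 with a
  · exact key a _
  · intro a l' hl'
    rw [← key]
    exact (size_sublist (List.filter_sublist.trans hl'.sublist)).trans (hq a)

@[fun_prop]
theorem any {l : α → List β} {f : α → β → Bool} (hl : PolyFun l)
    (hf : PolyFun fun p : α × β => f p.1 p.2) : PolyFun fun a => (l a).any (f a) := by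
  convert foldr (f := fun a x acc => f a x || acc) hl (const false)
    (or (hf.comp (f := fun p : α × β × Bool => (p.1, p.2.1)) (by fun_prop)) (by fun_prop))
    3 ?_ using 2 with a
  · induction l a with
    | nil => rfl
    | cons x l ih => rw [List.any_cons, ih, List.foldr_cons]
  · intro a l' _
    simpa using size_bool_le _

@[fun_prop]
theorem all {l : α → List β} {f : α → β → Bool} (hl : PolyFun l)
    (hf : PolyFun fun p : α × β => f p.1 p.2) : PolyFun fun a => (l a).all (f a) := by
  convert (any (f := fun a x => !f a x) hl hf.not).not using 2 with a
  induction l a with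
  | nil => rfl
  | cons x l ih => simp [ih]

@[fun_prop]
theorem append {l l' : α → List β} (hl : PolyFun l) (hl' : PolyFun l') :
    PolyFun fun a => l a ++ l' a := by
  obtain ⟨q, hq⟩ := hl.size
  obtain ⟨q', hq'⟩ := hl'.size
  convert foldr (f := fun _ x acc => x :: acc) hl hl' (by fun_prop) (q + q') ?_ using 2 with a
  · simp
  · intro a k hk
    have h₁ := size_append k (l' a)
    have h₂ := (size_sublist hk.sublist).trans (hq a)
    have h₃ := hq' a
    rw [List.foldr_cons_eq_append', Polynomial.eval_add]
    omega

@[fun_prop]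
theorem flatten {l : α → List (List β)} (hl : PolyFun l) : PolyFun fun a => (l a).flatten := by
  have key : ∀ l : List (List β), l.flatten = l.foldr (fun x acc => x ++ acc) [] := by
    intro l
    induction l with
    | nil => rfl
    | cons x l ih => rw [List.flatten_cons, ih, List.foldr_cons]
  obtain ⟨q, hq⟩ := hl.size
  convert foldr (f := fun _ x acc => x ++ acc) hl (const ([] : List β)) (by fun_prop) q ?_ using 2
  · exact key _
  · intro a l' hl'
    rw [← key]
    refine le_trans ?_ ((size_sublist hl'.sublist).trans (hq a))
    clear hl'
    induction l' with
    | nil => exact le_rfl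
    | cons x l ih =>
      have := size_append x l.flatten
      rw [List.flatten_cons, size_cons]
      omega

@[fun_prop]
theorem flatMap {l : α → List β} {f : α → β → List γ} (hl : PolyFun l)
    (hf : PolyFun fun p : α × β => f p.1 p.2) : PolyFun fun a => (l a).flatMap (f a) := by
  simpa only [List.flatMap_def] using (hl.map hf).flatten

end PolyFun

/-! ### Equality -/

/-- This only serves to state equality as a Boolean; the computation is done by `compareStep`. -/
noncomputable instance : DecidableEq Tree := Classical.decEq Tree

/-- One step of the comparison of two trees: a stack of pairs that have to be compared, and a flag
that is lowered when a difference is found. -/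
def compareStep (s : List (Tree × Tree) × Bool) : List (Tree × Tree) × Bool :=
  match s.1 with
  | [] => s
  | (.nil, .nil) :: t => (t, s.2)
  | (.cons l r, .cons l' r') :: t => ((l, l') :: (r, r') :: t, s.2)
  | _ :: _ => ([], false)

/-- When a pair of inner nodes is split, the two nodes removed from the trees pay for the two nodes
added to the stack. -/
theorem size_compareStep_le (s : List (Tree × Tree) × Bool) :
    (enc (compareStep s)).size ≤ (enc s).size := by
  obtain ⟨_ | ⟨⟨_ | ⟨l, r⟩, _ | ⟨l', r'⟩⟩, t⟩, x⟩ := s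
  · exact le_rfl
  all_goals
    simp only [compareStep, size_pair, size_cons, size_nil, enc_tree, Tree.size, enc_false]
    have := one_le_size (enc x)
    have := one_le_size (enc t)
    omega

/-- The total size of the left trees on the stack drops at every step, which bounds the number of
steps; a mismatch empties the stack at once. -/
theorem compareStep_correct : ∀ (n : ℕ) (s : List (Tree × Tree) × Bool),
    (s.1.map fun p => p.1.size).sum ≤ n → ∃ k ≤ n,
      (∀ j < k, (compareStep^[j] s).1 ≠ []) ∧ (compareStep^[k] s).1 = [] ∧
      (compareStep^[k] s).2 = (s.2 && s.1.all fun p => decide (p.1 = p.2)) := by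
  intro n
  induction n with
  | zero =>
    rintro ⟨_ | ⟨⟨x, y⟩, t⟩, b⟩ h
    · exact ⟨0, le_rfl, by simp, rfl, by simp⟩
    · have := one_le_size x
      simp at h
      omega
  | succ n ih =>
    rintro ⟨_ | ⟨⟨x, y⟩, t⟩, b⟩ h
    · exact ⟨0, by omega, by simp, rfl, by simp⟩
    · have hs : ((compareStep ((x, y) :: t, b)).1.map fun p => p.1.size).sum ≤ n := by
        rcases x with _ | ⟨l, r⟩ <;> rcases y with _ | ⟨l', r'⟩ <;>
          simp only [compareStep, List.map_cons, List.sum_cons, List.map_nil, List.sum_nil,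
            Tree.size] at h ⊢ <;> omega
      obtain ⟨k, hk, h₁, h₂, h₃⟩ := ih _ hs
      refine ⟨k + 1, by omega, ?_, h₂, ?_⟩
      · rintro (_ | j) hj
        · simp
        · exact h₁ j (by omega)
      · refine h₃.trans ?_
        rcases x with _ | ⟨l, r⟩ <;> rcases y with _ | ⟨l', r'⟩ <;>
          simp [compareStep, Bool.and_assoc]

namespace PolyFun

theorem isNil {f : α → Tree} (hf : PolyFun f) :
    PolyFun fun a => (match f a with | .nil => true | .cons _ _ => false) :=
  branch hf (const false) (const true)
    (fun a h => by
      cases hfa : f a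
      · exact absurd hfa h
      · rfl)
    (fun a h => by
      rw [enc_tree] at h
      simp only [h])

theorem compareStep : PolyFun compareStep := by
  refine list_cases (l := fun s => s.1) (f := fun s => s)
    (g := fun s p t =>
      bif (match p.1 with | .nil => true | .cons _ _ => false) then
        bif (match p.2 with | .nil => true | .cons _ _ => false) then (t, s.2) else ([], false)
      else
        bif (match p.2 with | .nil => true | .cons _ _ => false) then ([], false)
        else ((p.1.hd, p.2.hd) :: (p.1.tl, p.2.tl) :: t, s.2)) (by fun_prop) (by fun_prop) ?_ ?_ ?_
  · refine cond (isNil (by fun_prop)) (cond (isNil (by fun_prop)) ?_ ?_)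
      (cond (isNil (by fun_prop)) ?_ ?_) <;> fun_prop
  · rintro ⟨l, s⟩ (rfl : l = [])
    rfl
  · rintro ⟨l, s⟩ ⟨_ | ⟨l₁, r₁⟩, _ | ⟨l₂, r₂⟩⟩ t (rfl : l = _ :: t) <;> rfl

theorem tree_eq : PolyFun fun p : Tree × Tree => decide (p.1 = p.2) := by
  refine while_loop (init := fun p => ([p], true)) (by fun_prop) compareStep Polynomial.X
    (Polynomial.X + 6) fun p => ?_
  obtain ⟨k, hk, h₁, h₂, h₃⟩ := compareStep_correct _ ([p], true) le_rfl
  have hbound : ∀ k, (enc (ModuleExtraction.compareStep^[k] ([p], true))).size ≤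
      (enc (([p], true) : List (Tree × Tree) × Bool)).size := by
    intro k
    induction k with
    | zero => exact le_rfl
    | succ k ih =>
      rw [Function.iterate_succ_apply']
      exact (size_compareStep_le _).trans ih
  refine ⟨k, hk.trans ?_, fun j hj h => h₁ j hj ?_, by rw [h₂, enc_nil],
    fun j _ => (hbound j).trans ?_, by simpa using h₃⟩
  · simp only [List.map_cons, List.map_nil, List.sum_cons, List.sum_nil, Polynomial.eval_X]
    change _ ≤ p.1.size + p.2.size + 1
    omega
  · cases hl : (ModuleExtraction.compareStep^[j] ([p], true)).1 with
    | nil => rfl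
    | cons x t =>
      rw [hl, enc_cons] at h
      cases h
  · simp only [size_pair, size_cons, size_nil, Polynomial.eval_add, Polynomial.eval_X,
      Polynomial.eval_ofNat]
    have := size_bool_le true
    omega

@[fun_prop]
-- Encodings are injective, so equality in any encoded type reduces to equality of trees.
theorem decide_eq [DecidableEq β] {f g : α → β} (hf : PolyFun f) (hg : PolyFun g) :
    PolyFun fun a => decide (f a = g a) := by
  refine of_enc (g := fun a => decide (enc (f a) = enc (g a))) ?_ (fun a => a)
    (fun _ => rfl) fun a => ?_
  · refine tree_eq.comp (f := fun a => (enc (f a), enc (g a))) ?_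
    exact of_enc (hf.pair hg) (fun a => a) (fun _ => rfl) fun _ => rfl
  · congr 1
    exact decide_eq_decide.2 (inj.eq_iff).symm

end PolyFun

end

/-! ## Encodings of rules and facts -/

theorem encNat_injective : Function.Injective encNat := by
  intro a b h
  have h' : a.bits = b.bits := encList_injective (Enc.inj (α := Bool)) h
  have h'' : Nat.digits 2 a = Nat.digits 2 b := by
    rw [Nat.digits_two_eq_bits, Nat.digits_two_eq_bits, h']
  exact Nat.digits_inj_iff.1 h''

instance : Enc ℕ := ⟨encNat, encNat_injective⟩

instance : Enc PredName := ⟨encPredName, by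
  rintro (_ | _ | a) (_ | _ | b) h <;> simp [encPredName] at h ⊢
  exact encNat_injective h⟩

/-- Arities are encoded in unary, unlike names, so they are computed with as lists of units. -/
theorem encList_replicate (n : ℕ) :
    encList id (List.replicate n Tree.nil) = enc (List.replicate n ()) := by
  induction n with
  | zero => rfl
  | succ n ih => simp only [List.replicate_succ, encList, ih, enc_cons]; rfl

instance : Enc Pred := ⟨encPred, by
  rintro ⟨a, k⟩ ⟨b, l⟩ h
  simp only [encPred, Tree.cons.injEq, encList_replicate] at h
  have h₁ : a = b := inj h.1
  have h₂ := congrArg List.length (inj h.2)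
  simp only [List.length_replicate] at h₂
  rw [h₁, h₂]⟩

instance {τ : Type} [Enc τ] : Enc (Atom τ) := ⟨fun a => .cons (enc a.name) (enc a.args), by
  rintro ⟨a, k⟩ ⟨b, l⟩ h
  simp only [Tree.cons.injEq] at h
  rw [inj h.1, inj h.2]⟩

/-- Encoding of constants. -/
def encConst : Const → Tree
  | .star => .nil
  | .ex y => enc (([] : List Unit), y)
  | .crit A i => enc ([()], A, List.replicate i ())

instance : Enc Const := ⟨encConst, by
  rintro (_ | y | ⟨A, i⟩) (_ | y' | ⟨A', i'⟩) h <;>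
    simp only [encConst, enc_pair, enc_cons, enc_nil, Tree.cons.injEq, reduceCtorEq, false_and,
      true_and] at h ⊢
  · rw [inj h]
  · have h₂ := congrArg List.length (inj h.2)
    simp only [List.length_replicate] at h₂
    rw [inj h.1, h₂]⟩

instance : Enc Rule := ⟨encRule, by
  rintro ⟨b, h⟩ ⟨b', h'⟩ e
  change enc (b, h) = enc (b', h') at e
  cases inj e
  rfl⟩

instance : Enc Insep := ⟨encInsep, by
  rintro (_ | _ | _ | _ | _) (_ | _ | _ | _ | _) h <;> simp_all [encInsep]⟩

instance : Enc Input := ⟨Input.enc, by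
  rintro ⟨a, b, c, d⟩ ⟨a', b', c', d'⟩ e
  change enc (a, b, c, d) = enc (a', b', c', d') at e
  cases inj e
  rfl⟩

/-! ### Access to the components of encoded objects. -/

namespace PolyFun

section

variable {α β γ δ : Type} [Enc α] [Enc β] [Enc γ] [Enc δ]

@[fun_prop]
theorem decide_mem [DecidableEq β] {f : α → β} {l : α → List β} (hf : PolyFun f)
    (hl : PolyFun l) : PolyFun fun a => decide (f a ∈ l a) := by
  have h : PolyFun fun a => (l a).any fun b => decide (b = f a) := by fun_prop
  convert h using 2 with a
  rw [Bool.eq_iff_iff]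
  simp

@[fun_prop]
theorem input_z {f : α → Input} (hf : PolyFun f) : PolyFun fun a => (f a).z :=
  comp (g := fun I => I.z) (of_enc (g := fun p : Insep × List Rule × List Pred × Rule => p.1)
    (by fun_prop) (fun I => (I.z, I.rules, I.preds, I.axm)) (fun _ => rfl) fun _ => rfl) hf

@[fun_prop]
theorem input_rules {f : α → Input} (hf : PolyFun f) : PolyFun fun a => (f a).rules :=
  comp (g := fun I => I.rules) (of_enc (g := fun p : Insep × List Rule × List Pred × Rule => p.2.1)
    (by fun_prop) (fun I => (I.z, I.rules, I.preds, I.axm)) (fun _ => rfl) fun _ => rfl) hf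

@[fun_prop]
theorem input_preds {f : α → Input} (hf : PolyFun f) : PolyFun fun a => (f a).preds :=
  comp (g := fun I => I.preds)
    (of_enc (g := fun p : Insep × List Rule × List Pred × Rule => p.2.2.1)
    (by fun_prop) (fun I => (I.z, I.rules, I.preds, I.axm)) (fun _ => rfl) fun _ => rfl) hf

@[fun_prop]
theorem input_axm {f : α → Input} (hf : PolyFun f) : PolyFun fun a => (f a).axm :=
  comp (g := fun I => I.axm) (of_enc (g := fun p : Insep × List Rule × List Pred × Rule => p.2.2.2)
    (by fun_prop) (fun I => (I.z, I.rules, I.preds, I.axm)) (fun _ => rfl) fun _ => rfl) hf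

@[fun_prop]
theorem rule_body {f : α → Rule} (hf : PolyFun f) : PolyFun fun a => (f a).body :=
  comp (g := fun r => r.body)
    (of_enc (g := fun p : List (Atom Var) × List (List (Atom Var)) => p.1)
    (by fun_prop) (fun r => (r.body, r.head)) (fun _ => rfl) fun _ => rfl) hf

@[fun_prop]
theorem rule_head {f : α → Rule} (hf : PolyFun f) : PolyFun fun a => (f a).head :=
  comp (g := fun r => r.head)
    (of_enc (g := fun p : List (Atom Var) × List (List (Atom Var)) => p.2)
    (by fun_prop) (fun r => (r.body, r.head)) (fun _ => rfl) fun _ => rfl) hf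

@[fun_prop]
theorem atom_name {f : α → Atom β} (hf : PolyFun f) : PolyFun fun a => (f a).name :=
  comp (g := fun r => r.name) (of_enc (g := fun p : PredName × List β => p.1)
    (by fun_prop) (fun r => (r.name, r.args)) (fun _ => rfl) fun _ => rfl) hf

@[fun_prop]
theorem atom_args {f : α → Atom β} (hf : PolyFun f) : PolyFun fun a => (f a).args :=
  comp (g := fun r => r.args) (of_enc (g := fun p : PredName × List β => p.2)
    (by fun_prop) (fun r => (r.name, r.args)) (fun _ => rfl) fun _ => rfl) hf

@[fun_prop]
theorem atom_mk {f : α → PredName} {g : α → List β} (hf : PolyFun f) (hg : PolyFun g) :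
    PolyFun fun a => (⟨f a, g a⟩ : Atom β) :=
  of_enc (hf.pair hg) (fun a => a) (fun _ => rfl) fun _ => rfl

@[fun_prop]
theorem atom_map {f : α → β → γ} {g : α → Atom β} (hf : PolyFun fun p : α × β => f p.1 p.2)
    (hg : PolyFun g) : PolyFun fun a => (g a).map (f a) := by
  unfold Atom.map
  fun_prop

@[fun_prop]
theorem atom_pred {f : α → Atom β} (hf : PolyFun f) : PolyFun fun a => (f a).pred :=
  of_enc (g := fun a => ((f a).name, (f a).args.map fun _ => ())) (by fun_prop) (fun a => a)
    (fun _ => rfl) fun a => by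
      rw [List.map_const', enc_pair, ← encList_replicate]
      rfl

@[fun_prop]
theorem pred_name {f : α → Pred} (hf : PolyFun f) : PolyFun fun a => (f a).name :=
  comp (g := fun A => A.name) (of_enc (g := fun p : PredName × List Unit => p.1)
    (by fun_prop) (fun A => (A.name, List.replicate A.arity ()))
    (fun A => by
      rw [enc_pair, ← encList_replicate]
      rfl)
    fun _ => rfl) hf

@[fun_prop]
theorem pred_arity {f : α → Pred} (hf : PolyFun f) :
    PolyFun fun a => List.replicate (f a).arity () :=
  comp (g := fun A => List.replicate A.arity ()) (of_enc (g := fun p : PredName × List Unit => p.2)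
    (by fun_prop) (fun A => (A.name, List.replicate A.arity ()))
    (fun A => by
      rw [enc_pair, ← encList_replicate]
      rfl)
    fun _ => rfl) hf

@[fun_prop]
theorem const_ex {f : α → Var} (hf : PolyFun f) : PolyFun fun a => Const.ex (f a) :=
  of_enc (g := fun a => (([] : List Unit), f a)) (by fun_prop) (fun a => a) (fun _ => rfl)
    fun _ => rfl

end

end PolyFun

/-- The arguments of the fact `A(c_A^1, …, c_A^n)`. -/
def critArgs (A : Pred) : List Const := (List.range A.arity).map (Const.crit A)

/-- The index is counted in unary in the first component while the constants accumulate in reverse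
order in the second. -/
theorem foldl_crit (A : Pred) (l : List Unit) :
    l.foldl (fun (p : List Unit × List Const) _ => (() :: p.1, Const.crit A p.1.length :: p.2))
      ([], []) =
    (List.replicate l.length (), ((List.range l.length).map (Const.crit A)).reverse) := by
  induction l using List.reverseRecOn with
  | nil => rfl
  | append_singleton l _ ih =>
    rw [List.foldl_append, ih]
    simp [List.range_succ, List.replicate_succ]

@[fun_prop]
theorem PolyFun.critArgs : PolyFun critArgs := by
  have hmk : PolyFun fun p : Pred × List Unit => Const.crit p.1 p.2.length :=
    of_enc (g := fun p => ([()], p)) (by fun_prop) (fun p => p) (fun _ => rfl) fun p => by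
      change enc ([()], p.1, List.replicate p.2.length ()) = enc ([()], p.1, p.2)
      congr 3
      exact (List.eq_replicate_length.2 fun _ _ => rfl).symm
  have h : PolyFun fun A : Pred => ((List.replicate A.arity ()).foldl
      (fun (p : List Unit × List Const) _ => (() :: p.1, Const.crit A p.1.length :: p.2))
      ([], [])).2.reverse := by
    refine reverse (snd (foldl (l := fun A : Pred => List.replicate A.arity ())
      (init := fun _ => (([] : List Unit), ([] : List Const)))
      (f := fun A p _ => (() :: p.1, Const.crit A p.1.length :: p.2))
      (by fun_prop) (by fun_prop) (pair (by fun_prop) (cons ?_ (by fun_prop)))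
      -- Each constant `c_A^i` with `i` below the arity has size at most `2 * X + 5`: the tag and
      -- two pair nodes give 5, the predicate and the unary index at most `X` each.
      (Polynomial.X + (Polynomial.X * (2 * Polynomial.X + 5 + 1) + 2)) ?_))
    · exact hmk.comp (f := fun p : Pred × (List Unit × List Const) × Unit => (p.1, p.2.1.1))
        (by fun_prop)
    · intro A l hl
      have hrep : (enc (List.replicate A.arity ())).size ≤ (enc A).size := by
        rw [← encList_replicate]
        change _ ≤ _ + Tree.size _ + 1
        omega
      have hlen : l.length ≤ A.arity := by simpa using hl.length_le
      have hrep' : ∀ i ≤ A.arity, (enc (List.replicate i ())).size ≤ (enc A).size := fun i hi =>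
        (size_sublist ((List.replicate_sublist_replicate ()).2 hi)).trans hrep
      have hlen' : l.length ≤ (enc A).size :=
        hlen.trans (by simpa using (length_le_size (List.replicate A.arity ())).trans hrep)
      rw [foldl_crit, size_pair, size_reverse]
      have h₁ := hrep' _ hlen
      have h₂ := size_le_length_mul (l := (List.range l.length).map (Const.crit A))
        (n := 2 * (enc A).size + 5) (by
          intro c hc
          obtain ⟨i, hi, rfl⟩ := List.mem_map.1 hc
          change (enc ([()], A, List.replicate i ())).size ≤ _
          have := hrep' i (by have := List.mem_range.1 hi; omega)
          have h3 : (enc [()]).size = 3 := rfl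
          rw [size_pair, size_pair, h3]
          omega)
      rw [List.length_map, List.length_range] at h₂
      have h₃ := Nat.mul_le_mul_right (2 * (enc A).size + 5 + 1) hlen'
      simp only [Polynomial.eval_add, Polynomial.eval_X, Polynomial.eval_mul,
        Polynomial.eval_ofNat, Polynomial.eval_one]
      omega
  convert h using 2 with A
  rw [foldl_crit]
  simp [ModuleExtraction.critArgs]

/-! ## The algorithm -/

/-- The value of an assignment, given as an association list. -/
def lookup (σ : List (Var × Const)) (x : Var) : Const :=
  σ.foldr (fun p c => bif decide (p.1 = x) then p.2 else c) .star

/-- All lists of at most `m` elements of `l`. -/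
def shortLists {α : Type} (l : List α) : ℕ → List (List α)
  | 0 => [[]]
  | m + 1 => [] :: l.flatMap fun p => (shortLists l m).map (p :: ·)

/-- The least sublist of `l` that contains all `a` in `l` with `p S a`, where `S` is the sublist
itself. -/
def lfpFilter {α : Type} (l : List α) (p : List α → α → Bool) : List α :=
  l.foldl (fun S _ => l.filter (p S)) []

/-- The constants that replace existentially quantified variables. -/
def skolemConst (z : Insep) (y : Var) : Const := bif decide (z = .m) then .star else .ex y

/-- The variables of the body. -/
def Rule.bodyVars (r : Rule) : List Var := r.body.flatMap Atom.args

/-- The atoms of the head, or falsehood if the head is empty. -/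
def Rule.headAtoms (r : Rule) : List (Atom Var) :=
  bif decide (r.head = []) then [⟨.bot, []⟩] else r.head.flatten

/-- The instance of a head atom for an assignment. -/
def Rule.groundHead (r : Rule) (z : Insep) (σ : List (Var × Const)) (a : Atom Var) : Fact :=
  a.map fun x => bif decide (x ∈ r.bodyVars) then lookup σ x else skolemConst z x

/-- The constants `∗` and `c_y`. -/
def starOrEx (T : List Rule) : List Const :=
  .star :: T.flatMap fun r => ((r.head.flatten.flatMap Atom.args).filter fun x =>
    !decide (x ∈ r.bodyVars)).map Const.ex

/-- All relevant constants. -/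
def Input.consts (I : Input) : List Const := starOrEx I.rules ++ I.preds.flatMap critArgs

/-- Instances of rules: the rule itself, the instance of its body, and the instance of an atom of
its head. -/
abbrev RuleInstance := Rule × List Fact × Fact

/-- The instances for assignments of relevant constants to at most `m` variables. -/
def Input.instances (m : ℕ) (I : Input) : List RuleInstance :=
  I.rules.flatMap fun r =>
    (shortLists (r.bodyVars.flatMap fun x => I.consts.map fun c => (x, c)) m).flatMap fun σ =>
      r.headAtoms.map fun a => (r, r.body.map (Atom.map (lookup σ)), r.groundHead I.z σ a)

/-- Whether the setting is one with constants `c_A^i`. -/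
def Insep.usesCrit (z : Insep) : Bool := decide (z = .i) || decide (z = .c)

/-- The initial facts. -/
def Input.initList (I : Input) : List Fact :=
  I.preds.map fun A => ⟨A.name, bif I.z.usesCrit then critArgs A
    else (List.replicate A.arity ()).map fun _ => Const.star⟩

/-- Whether a fact that heads an instance is one of those to be supported. -/
def Input.isRelevant (I : Input) (F : Fact) : Bool :=
  bif I.z.usesCrit then
    decide (F = Fact.falsum) || I.preds.any fun A => decide (F.args = critArgs A) &&
      (!decide (F.name = A.name) && (decide (I.z = .c) || decide (F.pred ∈ I.preds)))
  else
    bif decide (I.z = .q) then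
      decide (F.pred ∈ I.preds) && F.args.all fun c => decide (c ∈ starOrEx I.rules)
    else decide (F ∈ I.initList)

/-- Whether a fact is trivial, or initial, or the head of an instance in `S`. -/
def isDerived (A : List Fact) (S : List RuleInstance) (F : Fact) : Bool :=
  decide (F.name = .top) || (decide (F ∈ A) || S.any fun i => decide (i.2.2 = F))

/-- The instances whose body is derivable. -/
def Input.active (m : ℕ) (I : Input) : List RuleInstance :=
  lfpFilter (I.instances m) fun S i => i.2.1.all (isDerived I.initList S)

/-- The instances that contribute to the derivation of a relevant fact. -/
def Input.useful (m : ℕ) (I : Input) : List RuleInstance :=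
  lfpFilter (I.active m) fun S i => I.isRelevant i.2.2 || S.any fun j => decide (i.2.2 ∈ j.2.1)

/-- Whether the rule of the input has a contributing instance. -/
def Input.answer (m : ℕ) (I : Input) : Bool := (I.useful m).any fun i => decide (i.1 = I.axm)

/-! ### Running time of the algorithm. -/

namespace PolyFun

section

variable {α β : Type} [Enc α] [Enc β]

@[fun_prop]
theorem lookup {f : α → List (Var × Const)} {g : α → Var} (hf : PolyFun f) (hg : PolyFun g) :
    PolyFun fun a => lookup (f a) (g a) := by
  obtain ⟨q, hq⟩ := hf.size
  refine foldr (init := fun _ => Const.star)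
    (f := fun a p c => bif decide (p.1 = g a) then p.2 else c) hf (by fun_prop) (by fun_prop) q
    fun a l hl => le_trans ?_ ((size_sublist hl.sublist).trans (hq a))
  clear hl
  induction l with
  | nil => exact le_rfl
  | cons p l ih =>
    rw [List.foldr_cons, size_cons]
    cases decide (p.1 = g a)
    · rw [cond_false]
      omega
    · rw [cond_true]
      have := size_pair p.1 p.2
      rw [Prod.mk.eta] at this
      omega

@[fun_prop]
-- The recursion on `m` unfolds into a fixed composition, so program and polynomial depend on `m`.
-- This is where the bound on the number of variables is needed for polynomial time.
theorem shortLists {l : α → List β} (hl : PolyFun l) (m : ℕ) :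
    PolyFun fun a => shortLists (l a) m := by
  refine comp (g := fun l : List β => ModuleExtraction.shortLists l m) ?_ hl
  induction m with
  | zero => exact const _
  | succ m ih =>
    have h : PolyFun fun p : List β × β => ModuleExtraction.shortLists p.1 m :=
      ih.comp (fst PolyFun.id)
    exact cons (const []) (flatMap PolyFun.id (map h (by fun_prop)))

@[fun_prop]
-- Every stage is a sublist of `l`, so accumulators cannot outgrow it.
theorem lfpFilter {l : α → List β} {p : α → List β → β → Bool} (hl : PolyFun l)
    (hp : PolyFun fun x : α × List β × β => p x.1 x.2.1 x.2.2) :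
    PolyFun fun a => lfpFilter (l a) (p a) := by
  obtain ⟨q, hq⟩ := hl.size
  refine foldl (init := fun _ => ([] : List β)) (f := fun a S _ => (l a).filter (p a S)) hl
    (by fun_prop) ?_ q fun a l' hl' => ?_
  · refine filter (hl.comp (by fun_prop)) ?_
    exact hp.comp (f := fun x : (α × List β × β) × β => (x.1.1, x.1.2.1, x.2)) (by fun_prop)
  · refine le_trans (size_sublist ?_) (hq a)
    cases l' using List.reverseRecOn with
    | nil => exact List.nil_sublist _
    | append_singleton l' x =>
      rw [List.foldl_append]
      exact List.filter_sublist

@[fun_prop]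
theorem bodyVars {f : α → Rule} (hf : PolyFun f) : PolyFun fun a => (f a).bodyVars := by
  unfold Rule.bodyVars
  fun_prop

@[fun_prop]
theorem headAtoms {f : α → Rule} (hf : PolyFun f) : PolyFun fun a => (f a).headAtoms := by
  unfold Rule.headAtoms
  fun_prop

@[fun_prop]
theorem starOrEx : PolyFun starOrEx := by
  unfold ModuleExtraction.starOrEx
  fun_prop

@[fun_prop]
theorem consts : PolyFun Input.consts := by
  unfold Input.consts
  fun_prop

theorem instances (m : ℕ) : PolyFun (Input.instances m) := by
  unfold Input.instances Rule.groundHead skolemConst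
  fun_prop

@[fun_prop]
theorem initList : PolyFun Input.initList := by
  unfold Input.initList Insep.usesCrit
  fun_prop

theorem isRelevant : PolyFun fun p : Input × Fact => p.1.isRelevant p.2 := by
  unfold Input.isRelevant Insep.usesCrit
  fun_prop

theorem active (m : ℕ) : PolyFun (Input.active m) := by
  have := instances m
  unfold Input.active isDerived
  fun_prop

theorem useful (m : ℕ) : PolyFun (Input.useful m) := by
  have := active m
  have := isRelevant
  unfold Input.useful
  fun_prop

theorem answer (m : ℕ) : PolyFun (Input.answer m) := by
  have := useful m
  unfold Input.answer
  fun_prop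

end

end PolyFun

theorem polyTimeDecidableOn_of_polyFun {f : Input → Bool} (hf : PolyFun f) {D : Set Input}
    {Q : Input → Prop} (h : ∀ I ∈ D, f I = true ↔ Q I) :
    PolyTimeDecidableOn Input.enc D Q := by
  obtain ⟨c, p, hc⟩ := hf.prog 0
  refine ⟨c, p, fun I hI => ?_⟩
  obtain ⟨s, t, he, ht, hs, -⟩ := hc I (initStore I.enc) (by simp [initStore]; rfl)
  refine ⟨s, t, he, ht, ?_⟩
  rw [hs, ← h I hI]
  cases f I
  · simp [enc_false]
  · simp [enc_true]

/-! ## Correctness of the algorithm -/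

section

variable {α : Type} {l : List α} {p : List α → α → Bool}

/-- Leastness, in the form used for soundness; it holds stage by stage, for arbitrary `p`. -/
theorem lfpFilter_induction {Q : α → Prop}
    (h : ∀ S : List α, (∀ a ∈ S, Q a) → ∀ a ∈ l, p S a = true → Q a) : ∀ a ∈ lfpFilter l p, Q a := by
  have key : ∀ k S : List α, (∀ a ∈ S, Q a) →
      ∀ a ∈ k.foldl (fun S _ => l.filter (p S)) S, Q a := by
    intro k
    induction k with
    | nil => exact fun S hS => hS
    | cons x k ih =>
      intro S hS
      exact ih _ fun a ha => h S hS a (List.mem_filter.1 ha).1 (List.mem_filter.1 ha).2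
  exact key l [] (by simp)

/-- For monotone `p` the stages form an increasing chain of sublists of `l`. Until it is stationary
each stage gains an element, so after `l.length` rounds it has reached a fixed point. -/
theorem mem_lfpFilter (hp : ∀ S S' : List α, S ⊆ S' → ∀ a, p S a = true → p S' a = true) (a : α) :
    a ∈ lfpFilter l p ↔ a ∈ l ∧ p (lfpFilter l p) a = true := by
  let F : List α → List α := fun S => l.filter (p S)
  have hF : lfpFilter l p = F^[l.length] [] := by
    have : ∀ k S : List α, k.foldl (fun S _ => l.filter (p S)) S = F^[k.length] S := by
      intro k
      induction k with
      | nil => exact fun S => rfl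
      | cons x k ih => exact fun S => ih _
    exact this l []
  have hmono : ∀ k, (F^[k] []).Sublist (F^[k + 1] []) := by
    intro k
    induction k with
    | zero => exact List.nil_sublist _
    | succ k ih =>
      rw [Function.iterate_succ_apply', Function.iterate_succ_apply' F (k + 1)]
      exact List.monotone_filter_right _ (hp _ _ ih.subset)
  have hgrow : ∀ k, F^[k + 1] [] = F^[k] [] ∨ k ≤ (F^[k] []).length := by
    intro k
    induction k with
    | zero => exact .inr (Nat.zero_le _)
    | succ k ih =>
      by_cases hk : F^[k + 1] [] = F^[k] []
      · left
        rw [Function.iterate_succ_apply', hk, ← Function.iterate_succ_apply' F, hk]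
      · right
        have h₁ := ih.resolve_left hk
        have h₂ := (hmono k).length_le
        have h₃ : (F^[k] []).length ≠ (F^[k + 1] []).length := fun h =>
          hk ((hmono k).eq_of_length h).symm
        omega
  have hfix : F^[l.length + 1] [] = F^[l.length] [] := by
    rcases hgrow l.length with h | h
    · exact h
    · refine ((hmono _).eq_of_length_le (le_trans ?_ h)).symm
      rw [Function.iterate_succ_apply']
      exact List.length_filter_le _ _
  rw [Function.iterate_succ_apply', ← hF] at hfix
  conv_lhs => rw [← hfix]
  exact List.mem_filter

theorem mem_shortLists {m : ℕ} {k : List α} :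
    k ∈ shortLists l m ↔ k.length ≤ m ∧ ∀ a ∈ k, a ∈ l := by
  induction m generalizing k with
  | zero => cases k <;> simp [shortLists]
  | succ m ih =>
    cases k with
    | nil => simp [shortLists]
    | cons a k =>
      simp only [shortLists, List.mem_cons, reduceCtorEq, List.mem_flatMap, List.mem_map, ih,
        List.cons.injEq, false_or, List.length_cons, Nat.add_le_add_iff_right, forall_eq_or_imp]
      constructor
      · rintro ⟨_, h₁, _, h₂, rfl, rfl⟩
        exact ⟨h₂.1, h₁, h₂.2⟩
      · rintro ⟨h₁, h₂, h₃⟩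
        exact ⟨a, h₂, k, ⟨h₁, h₃⟩, rfl, rfl⟩

end

/-! ### Atoms, datalog rules and their instances. -/

theorem Atom.map_map {α β γ : Type} (g : β → γ) (f : α → β) (a : Atom α) :
    (a.map f).map g = a.map (g ∘ f) := by
  simp [Atom.map]

theorem Atom.map_congr {α β : Type} {f g : α → β} {a : Atom α} (h : ∀ x ∈ a.args, f x = g x) :
    a.map f = a.map g := by
  simp only [Atom.map, Atom.mk.injEq, true_and]
  exact List.map_congr_left h

theorem Atom.map_eq_self {α : Type} {f : α → α} {a : Atom α} (h : ∀ x ∈ a.args, f x = x) :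
    a.map f = a := by
  rw [Atom.map_congr (g := fun x => x) h]
  simp [Atom.map]

theorem Rule.mem_univVars {r : Rule} {x : Var} : x ∈ r.univVars ↔ x ∈ r.bodyVars :=
  List.mem_toFinset

theorem Rule.mem_headAtoms {r : Rule} {a : Atom Var} :
    a ∈ r.headAtoms ↔ (r.head = [] ∧ a = ⟨.bot, []⟩) ∨ ∃ ψ ∈ r.head, a ∈ ψ := by
  by_cases h : r.head = []
  · simp [headAtoms, h]
  · simp [headAtoms, h]

theorem Rule.mem_datalog {r : Rule} {θ : Var → Const} {d : DatalogRule} :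
    d ∈ r.datalog θ ↔ ∃ a ∈ r.headAtoms, d = ⟨r.body, r.skolem θ a⟩ := by
  simp only [mem_headAtoms]
  constructor
  · rintro (⟨h, rfl⟩ | ⟨ψ, hψ, a, ha, rfl⟩)
    · exact ⟨_, .inl ⟨h, rfl⟩, rfl⟩
    · exact ⟨a, .inr ⟨ψ, hψ, ha⟩, rfl⟩
  · rintro ⟨a, ⟨h, rfl⟩ | ⟨ψ, hψ, ha⟩, rfl⟩
    · exact .inl ⟨h, rfl⟩
    · exact .inr ⟨ψ, hψ, a, ha, rfl⟩

theorem Rule.map_skolem {r : Rule} (z : Insep) (σ : List (Var × Const)) (a : Atom Var) :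
    (r.skolem (skolemConst z) a).map (Sum.elim (lookup σ) id) = r.groundHead z σ a := by
  unfold skolem groundHead
  rw [Atom.map_map]
  refine Atom.map_congr fun x _ => ?_
  by_cases h : x ∈ r.bodyVars <;> simp [h, mem_univVars]

theorem mem_starOrEx {T : List Rule} {c : Const} :
    c ∈ starOrEx T ↔ c = .star ∨ ∃ y ∈ TBox.exVars T.toFinset, c = .ex y := by
  simp only [starOrEx, List.mem_cons, List.mem_flatMap, List.mem_map, List.mem_filter,
    TBox.exVars, Rule.exVars, Set.mem_ofPred_eq, List.mem_toFinset, Finset.mem_sdiff,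
    Rule.mem_univVars, Bool.not_eq_true', decide_eq_false_iff_not]
  refine or_congr_right ⟨?_, ?_⟩
  · rintro ⟨r, hr, y, hy, rfl⟩
    exact ⟨y, ⟨r, hr, hy⟩, rfl⟩
  · rintro ⟨y, ⟨r, hr, hy⟩, rfl⟩
    exact ⟨r, hr, y, hy, rfl⟩

theorem length_critArgs (A : Pred) : (critArgs A).length = A.arity := by
  simp [critArgs]

/-! ### The lists of the algorithm and the sets of the module setting. -/

namespace Input

/-- The module setting of an input. -/
def setting (I : Input) : Setting := ModuleExtraction.setting I.tbox I.sig I.z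

variable {I : Input} {m : ℕ}

theorem mem_tbox {r : Rule} : r ∈ I.tbox ↔ r ∈ I.rules := List.mem_toFinset

theorem mem_sig {A : Pred} : A ∈ I.sig ↔ A ∈ I.preds := List.mem_toFinset

theorem setting_theta : I.setting.θ = skolemConst I.z := by
  obtain ⟨z, _, _, _⟩ := I
  cases z <;> rfl

theorem mem_initList {F : Fact} : F ∈ I.initList ↔ F ∈ I.setting.A₀ := by
  simp only [initList, List.mem_map, List.map_replicate]
  obtain ⟨z, _, S, _⟩ := I
  cases z <;>
  · simp only [setting, ModuleExtraction.setting, starFacts, initFacts, Set.mem_ofPred_eq, mem_sig]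
    exact exists_congr fun A => and_congr_right fun _ => eq_comm

/-- For `z = c` no membership in the signature of the TBox is tested: by `hF` it is automatic for
heads of instances other than falsehood. Equal arguments force equal arities, so distinct predicates
can be recognised by their names. -/
theorem isRelevant_iff {F : Fact} (hF : F = Fact.falsum ∨ F.pred ∈ I.tbox.sig) :
    I.isRelevant F = true ↔ F ∈ I.setting.Aᵣ := by
  have hcrit : ∀ {A : Pred}, F.args = critArgs A → F.name ≠ A.name →
      A ≠ F.pred ∧ A.arity = F.pred.arity ∧ F = critFact A F.pred := by
    intro A hA hn
    refine ⟨fun h => hn ?_, ?_, ?_⟩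
    · rw [h]
      rfl
    · rw [← length_critArgs A, ← hA]
      rfl
    · change F = ⟨F.name, critArgs A⟩
      rw [← hA]
  have hcrit' : ∀ {A B : Pred}, A ≠ B → A.arity = B.arity → F = critFact A B →
      F.args = critArgs A ∧ F.name ≠ A.name ∧ F.pred = B := by
    rintro ⟨a, k⟩ ⟨b, _⟩ hAB rfl rfl
    refine ⟨rfl, fun h => hAB ?_, ?_⟩
    · rw [show a = b from h.symm]
    · simp [critFact, Atom.pred]
  cases hz : I.z
  case m =>
    simp only [isRelevant, Insep.usesCrit, hz, reduceCtorEq, decide_false, Bool.or_self,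
      cond_false, decide_eq_true_eq, mem_initList]
    simp only [setting, ModuleExtraction.setting, hz]
  case f =>
    simp only [isRelevant, Insep.usesCrit, hz, reduceCtorEq, decide_false, Bool.or_self,
      cond_false, decide_eq_true_eq, mem_initList]
    simp only [setting, ModuleExtraction.setting, hz]
  case q =>
    simp only [isRelevant, Insep.usesCrit, hz, reduceCtorEq, decide_false, Bool.or_self,
      cond_false, decide_true, cond_true, Bool.and_eq_true, decide_eq_true_eq, List.all_eq_true,
      mem_starOrEx, setting, ModuleExtraction.setting, Set.mem_ofPred_eq, mem_sig]
    rfl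
  case i =>
    simp only [isRelevant, Insep.usesCrit, hz, reduceCtorEq, decide_false, decide_true,
      Bool.or_false, Bool.false_or, cond_true, Bool.or_eq_true, Bool.and_eq_true,
      decide_eq_true_eq, List.any_eq_true, Bool.not_eq_true', decide_eq_false_iff_not,
      setting, ModuleExtraction.setting, Set.mem_ofPred_eq, mem_sig]
    refine or_congr_right ⟨?_, ?_⟩
    · rintro ⟨A, hA, h₁, h₂, h₃⟩
      exact ⟨A, hA, F.pred, h₃, hcrit h₁ h₂⟩
    · rintro ⟨A, hA, B, hB, h₁, h₂, h₃⟩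
      obtain ⟨h₄, h₅, h₆⟩ := hcrit' h₁ h₂ h₃
      exact ⟨A, hA, h₄, h₅, h₆ ▸ hB⟩
  case c =>
    simp only [isRelevant, Insep.usesCrit, hz, reduceCtorEq, decide_false, decide_true,
      Bool.or_true, Bool.true_or, cond_true, Bool.or_eq_true, Bool.and_eq_true,
      decide_eq_true_eq, List.any_eq_true, Bool.not_eq_true', decide_eq_false_iff_not,
      setting, ModuleExtraction.setting, Set.mem_ofPred_eq, mem_sig, and_true]
    by_cases hf : F = Fact.falsum
    · simp [hf]
    refine or_congr_right ⟨?_, ?_⟩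
    · rintro ⟨A, hA, h₁, h₂⟩
      exact ⟨A, hA, F.pred, hF.resolve_left hf, hcrit h₁ h₂⟩
    · rintro ⟨A, hA, B, hB, h₁, h₂, h₃⟩
      obtain ⟨h₄, h₅, h₆⟩ := hcrit' h₁ h₂ h₃
      exact ⟨A, hA, h₄, h₅⟩

/-- The assignments used for the instances of a rule. -/
def assignments (m : ℕ) (I : Input) (r : Rule) : List (List (Var × Const)) :=
  shortLists (r.bodyVars.flatMap fun x => I.consts.map fun c => (x, c)) m

theorem mem_instances {i : RuleInstance} : i ∈ I.instances m ↔
    ∃ r ∈ I.tbox, ∃ σ ∈ I.assignments m r, ∃ a ∈ r.headAtoms,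
      i = (r, r.body.map (Atom.map (lookup σ)), r.groundHead I.z σ a) := by
  simp only [instances, assignments, List.mem_flatMap, List.mem_map, mem_tbox]
  refine exists_congr fun r => and_congr_right fun _ => exists_congr fun σ =>
    and_congr_right fun _ => exists_congr fun a => and_congr_right fun _ => eq_comm

theorem head_of_mem_instances {i : RuleInstance} (hi : i ∈ I.instances m) :
    i.2.2 = Fact.falsum ∨ i.2.2.pred ∈ I.tbox.sig := by
  obtain ⟨r, hr, σ, -, a, ha, rfl⟩ := mem_instances.1 hi
  rcases Rule.mem_headAtoms.1 ha with ⟨-, rfl⟩ | ⟨ψ, hψ, ha⟩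
  · exact .inl rfl
  · refine .inr ⟨r, hr, .inr ⟨ψ, hψ, a, ha, ?_⟩⟩
    simp [Rule.groundHead, Atom.map, Atom.pred]

theorem isDerived_iff {A : List Fact} {S : List RuleInstance} {F : Fact} :
    isDerived A S F = true ↔ F.name = .top ∨ F ∈ A ∨ ∃ i ∈ S, i.2.2 = F := by
  simp [isDerived]

theorem mem_active {i : RuleInstance} : i ∈ I.active m ↔
    i ∈ I.instances m ∧ ∀ F ∈ i.2.1, isDerived I.initList (I.active m) F = true := by
  unfold active
  rw [mem_lfpFilter, List.all_eq_true]
  intro S S' hS i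
  simp only [List.all_eq_true, isDerived_iff]
  intro h F hF
  rcases h F hF with h | h | ⟨j, hj, h⟩
  · exact .inl h
  · exact .inr (.inl h)
  · exact .inr (.inr ⟨j, hS hj, h⟩)

theorem mem_useful {i : RuleInstance} : i ∈ I.useful m ↔
    i ∈ I.active m ∧ (i.2.2 ∈ I.setting.Aᵣ ∨ ∃ j ∈ I.useful m, i.2.2 ∈ j.2.1) := by
  unfold useful
  rw [mem_lfpFilter]
  · simp only [Bool.or_eq_true, List.any_eq_true, decide_eq_true_eq]
    refine and_congr_right fun hi => ?_
    rw [isRelevant_iff (head_of_mem_instances (mem_active.1 hi).1)]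
  · intro S S' hS i
    simp only [Bool.or_eq_true, List.any_eq_true, decide_eq_true_eq]
    rintro (h | ⟨j, hj, h⟩)
    · exact .inl h
    · exact .inr ⟨j, hS hj, h⟩

/-- Forward-chaining proofs for the setting of an input. -/
abbrev Proof (I : Input) : Fact → Type := DatalogProof (I.setting.program I.tbox) I.setting.A₀

/-! ### Soundness: from instances to proofs. -/

theorem instance_sound {i : RuleInstance} (hi : i ∈ I.instances m) :
    ∃ d ∈ i.1.datalog I.setting.θ, d ∈ I.setting.program I.tbox ∧ ∃ σ : Var → Const,
      i.2.1 = d.body.map (Atom.map σ) ∧ i.2.2 = d.head.map (Sum.elim σ id) := by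
  obtain ⟨r, hr, σ, -, a, ha, rfl⟩ := mem_instances.1 hi
  have hd : (⟨r.body, r.skolem I.setting.θ a⟩ : DatalogRule) ∈ r.datalog I.setting.θ :=
    Rule.mem_datalog.2 ⟨a, ha, rfl⟩
  refine ⟨_, hd, ⟨r, hr, hd⟩, lookup σ, rfl, ?_⟩
  rw [setting_theta]
  exact (Rule.map_skolem I.z σ a).symm

theorem active_sound : ∀ i ∈ I.active m, ∀ F ∈ i.2.1, Nonempty (I.Proof F) := by
  have key : ∀ i ∈ I.active m, i ∈ I.instances m ∧ ∀ F ∈ i.2.1, Nonempty (I.Proof F) := by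
    refine lfpFilter_induction fun S hS i hi h => ⟨hi, fun F hF => ?_⟩
    rw [List.all_eq_true] at h
    rcases isDerived_iff.1 (h F hF) with h | h | ⟨j, hj, rfl⟩
    · exact ⟨.truth F h⟩
    · exact ⟨.leaf F (mem_initList.1 h)⟩
    · obtain ⟨d, -, hd, σ, hbody, hhead⟩ := instance_sound (hS j hj).1
      rw [hhead]
      refine ⟨.node d hd σ fun k => ((hS j hj).2 _ ?_).some⟩
      rw [hbody]
      exact List.mem_map_of_mem (List.get_mem _ _)
  exact fun i hi => (key i hi).2

/-- Quantifying over all proofs `ρ` of the head makes the induction work: `ρ` is grafted below the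
instance that uses the head, and the resulting proof is passed on. -/
theorem useful_sound : ∀ i ∈ I.useful m, ∃ F ∈ I.setting.Aᵣ, ∀ ρ : I.Proof i.2.2,
    ∃ ρ' : I.Proof F, ρ.rules ⊆ ρ'.rules := by
  have key : ∀ i ∈ I.useful m, i ∈ I.active m ∧ ∃ F ∈ I.setting.Aᵣ, ∀ ρ : I.Proof i.2.2,
      ∃ ρ' : I.Proof F, ρ.rules ⊆ ρ'.rules := by
    refine lfpFilter_induction fun S hS i hi h => ⟨hi, ?_⟩
    simp only [Bool.or_eq_true, List.any_eq_true, decide_eq_true_eq] at h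
    rw [isRelevant_iff (head_of_mem_instances (mem_active.1 hi).1)] at h
    rcases h with h | ⟨j, hj, h⟩
    · exact ⟨_, h, fun ρ => ⟨ρ, subset_rfl⟩⟩
    · obtain ⟨hact, F, hF, hρ⟩ := hS j hj
      obtain ⟨d, -, hd, σ, hbody, hhead⟩ := instance_sound (mem_active.1 hact).1
      rw [hhead] at hρ
      have hch : ∀ k : Fin d.body.length, Nonempty (I.Proof ((d.body.get k).map σ)) := fun k =>
        active_sound j hact _ (by
          rw [hbody]
          exact List.mem_map_of_mem (List.get_mem _ _))
      rw [hbody] at h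
      obtain ⟨a, ha, hai⟩ := List.mem_map.1 h
      obtain ⟨k, rfl⟩ := List.get_of_mem ha
      refine ⟨F, hF, ?_⟩
      rw [← hai]
      intro ρ
      -- Child `k` is the given proof; the other children exist because the instance is active.
      obtain ⟨ρ', hρ'⟩ := hρ (.node d hd σ (Function.update (fun k => (hch k).some) k ρ))
      refine ⟨ρ', subset_trans ?_ hρ'⟩
      simp only [DatalogProof.rules]
      refine subset_trans ?_ Set.subset_union_right
      exact subset_trans (by simp) (Set.subset_iUnion _ k)
  exact fun i hi => (key i hi).2

theorem inModule_of_answer (haxm : I.axm ∈ I.tbox) (h : I.answer m = true) : I.InModule := by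
  simp only [answer, List.any_eq_true, decide_eq_true_eq] at h
  obtain ⟨i, hi, hr⟩ := h
  have hact := (mem_useful.1 hi).1
  obtain ⟨d, hd, hdP, σ, hbody, hhead⟩ := instance_sound (mem_active.1 hact).1
  obtain ⟨F, hF, hρ⟩ := useful_sound i hi
  have hch : ∀ k : Fin d.body.length, Nonempty (I.Proof ((d.body.get k).map σ)) := fun k =>
    active_sound i hact _ (by
      rw [hbody]
      exact List.mem_map_of_mem (List.get_mem _ _))
  rw [hhead] at hρ
  obtain ⟨ρ, hρ⟩ := hρ (.node d hdP σ fun k => (hch k).some)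
  rw [hr] at hd
  exact ⟨haxm, d, hd, hdP, F, hF, ρ, hρ (by simp [DatalogProof.rules])⟩

/-- A map of constants that fixes all facts of interest and sends arbitrary assignments to those
considered by the algorithm. -/
structure IsRetraction (m : ℕ) (I : Input) (h : Const → Const) : Prop where
  theta : ∀ y ∈ I.tbox.exVars, h (I.setting.θ y) = I.setting.θ y
  init : ∀ F ∈ I.setting.A₀, F.map h = F
  relevant : ∀ F ∈ I.setting.Aᵣ, F.map h = F
  assignment : ∀ r ∈ I.tbox, ∀ τ : Var → Const, ∃ σ ∈ I.assignments m r,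
    ∀ x ∈ r.bodyVars, lookup σ x = h (τ x)

/-! ### Completeness: from proofs to instances. -/

section

variable {h : Const → Const}

/-- The image under `h` of a rule application is an instance on the list: an assignment there agrees
with `h ∘ τ` on the body variables, and `h` fixes the constants of existential variables. -/
theorem IsRetraction.exists_active (hh : IsRetraction m I h) {r : Rule} (hr : r ∈ I.tbox)
    {d : DatalogRule} (hd : d ∈ r.datalog I.setting.θ) (τ : Var → Const)
    (hbody : ∀ a ∈ d.body, isDerived I.initList (I.active m) ((a.map τ).map h) = true) :
    ∃ i ∈ I.active m, i.1 = r ∧ i.2.1 = d.body.map (fun a => (a.map τ).map h) ∧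
      i.2.2 = (d.head.map (Sum.elim τ id)).map h := by
  obtain ⟨a, ha, rfl⟩ := Rule.mem_datalog.1 hd
  obtain ⟨σ, hσ, hστ⟩ := hh.assignment r hr τ
  have hb : r.body.map (Atom.map (lookup σ)) = r.body.map fun a => (a.map τ).map h := by
    refine List.map_congr_left fun b hb => ?_
    rw [Atom.map_map]
    exact Atom.map_congr fun x hx => hστ x (List.mem_flatMap.2 ⟨b, hb, hx⟩)
  refine ⟨(r, r.body.map (Atom.map (lookup σ)), r.groundHead I.z σ a), ?_, rfl, hb, ?_⟩
  · refine mem_active.2 ⟨mem_instances.2 ⟨r, hr, σ, hσ, a, ha, rfl⟩, fun F hF => ?_⟩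
    rw [hb] at hF
    obtain ⟨b, hb, rfl⟩ := List.mem_map.1 hF
    exact hbody b hb
  · change r.groundHead I.z σ a = ((r.skolem I.setting.θ a).map (Sum.elim τ id)).map h
    unfold Rule.groundHead Rule.skolem
    rw [Atom.map_map, Atom.map_map]
    refine Atom.map_congr fun x hx => ?_
    by_cases hxb : x ∈ r.bodyVars
    · simp [hxb, Rule.mem_univVars, hστ]
    · have hex : x ∈ I.tbox.exVars := by
        refine ⟨r, hr, Finset.mem_sdiff.2 ⟨?_, by rwa [Rule.mem_univVars]⟩⟩
        rcases Rule.mem_headAtoms.1 ha with ⟨-, rfl⟩ | ⟨ψ, hψ, ha⟩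
        · cases hx
        · rw [List.mem_toFinset]
          exact List.mem_flatMap.2 ⟨a, List.mem_flatten.2 ⟨ψ, hψ, ha⟩, hx⟩
      simp [hxb, Rule.mem_univVars, ← setting_theta, hh.theta x hex]

theorem IsRetraction.isDerived (hh : IsRetraction m I h) {F : Fact} (ρ : I.Proof F) :
    isDerived I.initList (I.active m) (F.map h) = true := by
  induction ρ with
  | leaf F hF =>
    rw [hh.init F hF]
    exact isDerived_iff.2 (.inr (.inl (mem_initList.2 hF)))
  | truth F hF => exact isDerived_iff.2 (.inl hF)
  | node d hd σ children ih =>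
    obtain ⟨r, hr, hdr⟩ := hd
    obtain ⟨i, hi, -, -, hhead⟩ := hh.exists_active hr hdr σ (by
      intro a ha
      obtain ⟨k, rfl⟩ := List.get_of_mem ha
      exact ih k)
    exact isDerived_iff.2 (.inr (.inr ⟨i, hi, hhead⟩))

/-- The hypothesis `hF` is the invariant passed from the root to the leaves. The rule `r` is
arbitrary because different rules may share a corresponding datalog rule, and then each of them
belongs to the module. -/
theorem IsRetraction.exists_useful (hh : IsRetraction m I h) {F : Fact} (ρ : I.Proof F)
    (hF : F.map h ∈ I.setting.Aᵣ ∨ ∃ j ∈ I.useful m, F.map h ∈ j.2.1) :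
    ∀ d ∈ ρ.rules, ∀ r ∈ I.tbox, d ∈ r.datalog I.setting.θ → ∃ i ∈ I.useful m, i.1 = r := by
  induction ρ with
  | leaf F _ => exact fun d hd => hd.elim
  | truth F _ => exact fun d hd => hd.elim
  | node d hd σ children ih =>
    have key : ∀ r ∈ I.tbox, d ∈ r.datalog I.setting.θ → ∃ i ∈ I.useful m, i.1 = r ∧
        i.2.1 = d.body.map (fun a => (a.map σ).map h) := by
      intro r hr hdr
      obtain ⟨i, hi, hir, hbody, hhead⟩ := hh.exists_active hr hdr σ (by
        intro a ha
        obtain ⟨k, rfl⟩ := List.get_of_mem ha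
        exact hh.isDerived (children k))
      exact ⟨i, mem_useful.2 ⟨hi, by rwa [hhead]⟩, hir, hbody⟩
    intro d' hd' r hr hdr
    rcases hd' with rfl | hd'
    · obtain ⟨i, hi, hir, -⟩ := key r hr hdr
      exact ⟨i, hi, hir⟩
    · obtain ⟨k, hk⟩ := Set.mem_iUnion.1 hd'
      -- Any rule `r₀` that yields the root's datalog rule provides a useful instance whose body
      -- contains the image of child `k`.
      obtain ⟨r₀, hr₀, hdr₀⟩ := hd
      obtain ⟨i, hi, -, hbody⟩ := key r₀ hr₀ hdr₀
      refine ih k (.inr ⟨i, hi, ?_⟩) d' hk r hr hdr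
      rw [hbody]
      exact List.mem_map.2 ⟨_, List.get_mem _ k, rfl⟩

theorem IsRetraction.answer_iff (hh : IsRetraction m I h) (haxm : I.axm ∈ I.tbox) :
    I.answer m = true ↔ I.InModule := by
  refine ⟨inModule_of_answer haxm, ?_⟩
  rintro ⟨-, d, hd, -, F, hF, ρ, hρ⟩
  obtain ⟨i, hi, hir⟩ := hh.exists_useful (F := F) ρ (.inl (by
    rw [hh.relevant F hF]
    exact hF)) d hρ I.axm haxm hd
  simp only [answer, List.any_eq_true, decide_eq_true_eq]
  exact ⟨i, hi, hir⟩

end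

/-! ### The two retractions. -/

theorem isRetraction_star (hz : I.z = .m) : IsRetraction m I fun _ => .star := by
  have hstar : ∀ F ∈ starFacts I.sig, Atom.map (fun _ => Const.star) F = F := by
    rintro _ ⟨A, -, rfl⟩
    exact Atom.map_eq_self fun x hx => (List.eq_of_mem_replicate hx).symm
  -- The empty assignment suffices, as `lookup` has the default value `∗`.
  refine ⟨fun y _ => ?_, ?_, ?_, fun r _ τ => ⟨[], ?_, fun x _ => rfl⟩⟩
  · rw [setting_theta, hz]
    rfl
  · simpa only [setting, ModuleExtraction.setting, hz] using hstar
  · simpa only [setting, ModuleExtraction.setting, hz] using hstar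
  · exact mem_shortLists.2 ⟨Nat.zero_le _, by simp⟩

theorem lookup_map {g : Var → Const} {l : List Var} {x : Var} (hx : x ∈ l) :
    lookup (l.map fun x => (x, g x)) x = g x := by
  induction l with
  | nil => cases hx
  | cons y l ih =>
    by_cases h : y = x
    · simp [lookup, h]
    · have := ih ((List.mem_cons.1 hx).resolve_left (Ne.symm h))
      simpa [lookup, h] using this

/-- Proofs may involve other constants, since facts over truth hold for all arguments; these
constants are sent to `∗`. -/
theorem isRetraction_consts (hz : I.z ≠ .m) (hm : ∀ r ∈ I.tbox, r.univVars.card ≤ m) :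
    IsRetraction m I fun c => if c ∈ I.consts then c else .star := by
  have hstar : Const.star ∈ I.consts :=
    List.mem_append_left _ (mem_starOrEx.2 (.inl rfl))
  have hex : ∀ y ∈ I.tbox.exVars, Const.ex y ∈ I.consts := fun y hy =>
    List.mem_append_left _ (mem_starOrEx.2 (.inr ⟨y, hy, rfl⟩))
  have hfix : ∀ F : Fact, (∀ c ∈ F.args, c ∈ I.consts) →
      F.map (fun c => if c ∈ I.consts then c else .star) = F := fun F hF =>
    Atom.map_eq_self fun c hc => if_pos (hF c hc)
  have hcrit : ∀ A ∈ I.sig, ∀ B, ∀ c ∈ (critFact A B).args, c ∈ I.consts := fun A hA B c hc =>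
    List.mem_append_right _ (List.mem_flatMap.2 ⟨A, mem_sig.1 hA, hc⟩)
  have hstarFacts : ∀ F ∈ starFacts I.sig, ∀ c ∈ F.args, c ∈ I.consts := by
    rintro _ ⟨A, -, rfl⟩ c hc
    rwa [List.eq_of_mem_replicate hc]
  have hinitFacts : ∀ F ∈ initFacts I.sig, ∀ c ∈ F.args, c ∈ I.consts := by
    rintro _ ⟨A, hA, rfl⟩
    exact hcrit A hA A
  refine ⟨fun y hy => if_pos ?_, fun F hF => hfix F ?_, fun F hF => hfix F ?_, fun r hr τ => ?_⟩
  · rw [setting_theta]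
    simpa [skolemConst, hz] using hex y hy
  · cases hz' : I.z <;> simp only [setting, ModuleExtraction.setting, hz'] at hF
    · exact hstarFacts F hF
    · exact hstarFacts F hF
    · exact hstarFacts F hF
    · exact hinitFacts F hF
    · exact hinitFacts F hF
  · cases hz' : I.z <;> simp only [setting, ModuleExtraction.setting, hz'] at hF
    · exact hstarFacts F hF
    · intro c hc
      rcases hF.2 c hc with rfl | ⟨y, hy, rfl⟩
      · exact hstar
      · exact hex y hy
    · exact hstarFacts F hF
    · rcases hF with rfl | ⟨A, hA, B, -, -, -, rfl⟩
      · simp [Fact.falsum]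
      · exact hcrit A hA B
    · rcases hF with rfl | ⟨A, hA, B, -, -, -, rfl⟩
      · simp [Fact.falsum]
      · exact hcrit A hA B
  -- The assignment lists each body variable once, so its length is the number of universal
  -- variables, at most `m`.
  · refine ⟨r.univVars.toList.map fun x => (x, if τ x ∈ I.consts then τ x else .star), ?_,
      fun x hx => lookup_map (by rwa [Finset.mem_toList, Rule.mem_univVars])⟩
    refine mem_shortLists.2 ⟨by simpa using hm r hr, fun p hp => ?_⟩
    obtain ⟨x, hx, rfl⟩ := List.mem_map.1 hp
    rw [Finset.mem_toList, Rule.mem_univVars] at hx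
    refine List.mem_flatMap.2 ⟨x, hx, List.mem_map.2 ⟨_, ?_, rfl⟩⟩
    split_ifs with hc
    · exact hc
    · exact hstar

end Input

end ModuleExtraction

theorem mainTheorem8 (L : Set ModuleExtraction.TBox) (hL : ∀ T ∈ L, T.WellFormed) :
    (∀ m : ℕ, (∀ T ∈ L, ∀ r ∈ T, r.univVars.card ≤ m) →
      ModuleExtraction.PolyTimeDecidableOn ModuleExtraction.Input.enc
        (ModuleExtraction.inputs {.q, .f, .i, .c} L) ModuleExtraction.Input.InModule) ∧
    ModuleExtraction.PolyTimeDecidableOn ModuleExtraction.Input.enc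
      (ModuleExtraction.inputs {.m} L) ModuleExtraction.Input.InModule := by
  refine ⟨fun m hm => ?_, ?_⟩
  · refine ModuleExtraction.polyTimeDecidableOn_of_polyFun (ModuleExtraction.PolyFun.answer m) ?_
    rintro I ⟨hz, hI, -, haxm⟩
    refine (ModuleExtraction.Input.isRetraction_consts ?_ (hm _ hI)).answer_iff haxm
    intro h
    simp [h] at hz
  -- With bound 0 only the empty assignment is listed, which maps all variables to `∗`.
  · refine ModuleExtraction.polyTimeDecidableOn_of_polyFun (ModuleExtraction.PolyFun.answer 0) ?_
    rintro I ⟨hz, -, -, haxm⟩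
    exact (ModuleExtraction.Input.isRetraction_star hz).answer_iff haxm
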